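/- Let $SG\subset\mathbb R^2$ be the Sierpinski gasket, the attractor of $F_i x=(x+q_i)/2$, $i=0,1,2$, where $q_0,q_1,q_2$ are the vertices of an equilateral triangle. For a word $w=w_1\dots w_m$ put $F_w=F_{w_1}\circ\dots\circ F_{w_m}$ (the sets $F_w(SG)$, $|w|=m$, are the $m$-cells), and let $V_m=\{F_wq_i: |w|=m,\ i=0,1,2\}$. Let $\mathcal E(u,v)=\lim_k (5/3)^k\sum_{x\sim_k y}(u(x)-u(y))(v(x)-v(y))$ be the standard energy, $\operatorname{dom}\mathcal E$ the continuous functions of finite energy, and $h_j$ the harmonic function with $h_j(q_i)=\delta_{ij}$. The normal derivative of $u$ at $F_wq_i$ with respect to the cell $F_w(SG)$, $|w|=m$, is $$\partial_n u(F_wq_i)=\lim_{k\to\infty}(5/3)^{m+k}\bigl(2u(F_wq_i)-u(F_wF_i^kq_{i+1})-u(F_wF_i^kq_{i-1})\bigr).$$ Let $\zeta$ be a finite Borel measure on $SG$ that is positive on nonempty open sets and has no atoms. We write $u\in\operatorname{dom}_{L^2}\Delta_\zeta$ with $\Delta_\zeta u=f\in L^2(\zeta)$ if $u\in\operatorname{dom}\mathcal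 E$ and $\mathcal E(u,v)=-\int fv\,d\zeta$ for all $v\in\operatorname{dom}\mathcal E$ with $v|_{V_0}=0$, and we put $T_\zeta(u)=\int|\Delta_\zeta u|^2d\zeta$. A function $u\in\operatorname{dom}_{L^2}\Delta_\zeta$ is called piecewise biharmonic on $m$-cells if, for every $|w|=m$, $(\Delta_\zeta u)\circ F_w$ is (represented by) a harmonic function. Let $m\ge 0$ and $E\subset V_m$, and assume that there are $x_1,x_2,x_3\in E$ for which the matrix $(h_j(x_k))_{k,j}$ is invertible. For each $x\in E$ fix real numbers $a_x,b_x$ and an $m$-cell having $x$ as a vertex, and let $$X=\{u\in\operatorname{dom}_{L^2}\Delta_\zeta:\ u(x)=a_x,\ \partial_n u(x)=b_x\ \text{for all } x\in E\},$$ where $\partial_nu(x)$ is taken with respect to the chosen cell. Then $T_\zeta$ has a unique minimizer $u$ in $X$. The minimizer is piecewise biharmonic on $m$-cells, and, at every $y\in V_m\setminus E$, the piecewise harmonic function $\Delta_\zeta u$ is continuous and has matching normal derivatives (the normal derivatives with respect to the two $m$-cells meeting at $y$ sum to zero); at a point $y\in V_0\setminus E$, which lies in only one $m$-cell, the latter conditions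 mean that $\Delta_\zeta u(y)=0$ and $\partial_n\Delta_\zeta u(y)=0$. Moreover, the minimizer is the only function in $X$ with these properties. -/

import Mathlib

open Filter Topology MeasureTheory

noncomputable section

namespace SierpinskiGasket

/-- The vertices `q₀, q₁, q₂` of an equilateral triangle, realized as the standard basis vectors
(the triangle lies in the plane `x₀ + x₁ + x₂ = 1`). -/
def vertex (i : Fin 3) : EuclideanSpace ℝ (Fin 3) := EuclideanSpace.single i 1

/-- The contraction `F_i x = (x + q_i) / 2`. -/
def contraction (i : Fin 3) (x : EuclideanSpace ℝ (Fin 3)) : EuclideanSpace ℝ (Fin 3) :=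
  (1 / 2 : ℝ) • (x + vertex i)

/-- The junction points of level `m` as a set of vectors: `V_0 = {q₀, q₁, q₂}` and
`V_{m+1} = ⋃ i, F_i V_m`. -/
def junctionVectors : ℕ → Set (EuclideanSpace ℝ (Fin 3))
  | 0 => Set.range vertex
  | m + 1 => ⋃ i, contraction i '' junctionVectors m

/-- The Sierpinski gasket: the closure of the set of all junction points. -/
def gasket : Set (EuclideanSpace ℝ (Fin 3)) := closure (⋃ m, junctionVectors m)

/-- The Sierpinski gasket as a space of its own, with the topology and the Borel structure
inherited from Euclidean space. -/
abbrev SG : Type := ↥gasket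

theorem vertex_mem (i : Fin 3) : vertex i ∈ gasket :=
  subset_closure (Set.mem_iUnion.2 ⟨0, i, rfl⟩)

theorem contraction_mem (i : Fin 3) {x : EuclideanSpace ℝ (Fin 3)} (hx : x ∈ gasket) :
    contraction i x ∈ gasket := by
  have hc : Continuous (contraction i) := by
    unfold contraction
    fun_prop
  refine map_mem_closure hc hx ?_
  intro y hy
  obtain ⟨m, hm⟩ := Set.mem_iUnion.1 hy
  exact Set.mem_iUnion.2 ⟨m + 1, Set.mem_iUnion.2 ⟨i, y, hm, rfl⟩⟩

/-- The boundary point `q_i` of the gasket. -/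
def q (i : Fin 3) : SG := ⟨vertex i, vertex_mem i⟩

/-- The map `F_i : SG → SG`. -/
def F (i : Fin 3) (x : SG) : SG := ⟨contraction i x, contraction_mem i x.2⟩

/-- `F_w = F_{w_1} ∘ ⋯ ∘ F_{w_m}` for a word `w` of length `m`; its range is the `m`-cell
`F_w(SG)`. -/
def cellMap : {m : ℕ} → (Fin m → Fin 3) → SG → SG
  | 0, _, x => x
  | _ + 1, w, x => F (w 0) (cellMap (Fin.tail w) x)

/-- The junction points `V_m = {F_w q_i : |w| = m}` of level `m`. -/
def V (m : ℕ) : Set SG := {x | ∃ (w : Fin m → Fin 3) (i : Fin 3), cellMap w (q i) = x}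

/-- The level `m` graph energy `(5/3)^m ∑ (u x - u y) (v x - v y)`, summed over the edges of the
level `m` graph: every edge is a side of exactly one triangle `F_w V_0` with `|w| = m`. -/
def graphEnergy (m : ℕ) (u v : SG → ℝ) : ℝ :=
  (5 / 3 : ℝ) ^ m * ∑ w : Fin m → Fin 3, ∑ i : Fin 3,
    (u (cellMap w (q i)) - u (cellMap w (q (i + 1)))) *
      (v (cellMap w (q i)) - v (cellMap w (q (i + 1))))

/-- `dom ℰ`: the continuous functions of finite energy. (`graphEnergy m u u` increases with `m`
to `ℰ(u)`, and `ℰ(u, v)` is the limit of `graphEnergy m u v`.) -/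
def InDomEnergy (u : SG → ℝ) : Prop :=
  Continuous u ∧ BddAbove (Set.range fun m => graphEnergy m u u)

/-- `u ∈ dom ℰ` has the Laplacian `Δ_ζ u = f ∈ L²(ζ)`: `ℰ(u, v) = -∫ f v dζ` for all `v ∈ dom ℰ`
that vanish on `V_0`. The function `f` is determined up to equality `ζ`-almost everywhere. -/
def HasLaplacian (ζ : Measure SG) (u f : SG → ℝ) : Prop :=
  InDomEnergy u ∧ MemLp f 2 ζ ∧
    ∀ v : SG → ℝ, InDomEnergy v → (∀ i, v (q i) = 0) →
      Tendsto (fun m => graphEnergy m u v) atTop (𝓝 (-∫ x, f x * v x ∂ζ))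

/-- `u ∈ dom_{L²} Δ_ζ`. -/
def InDomLaplacian (ζ : Measure SG) (u : SG → ℝ) : Prop := ∃ f, HasLaplacian ζ u f

open Classical in
/-- A representative of the class `Δ_ζ u ∈ L²(ζ)`, for `u ∈ dom_{L²} Δ_ζ`. -/
def laplacian (ζ : Measure SG) (u : SG → ℝ) : SG → ℝ :=
  if h : InDomLaplacian ζ u then h.choose else 0

/-- The functional `T_ζ(u) = ∫ (Δ_ζ u)² dζ`. -/
def T (ζ : Measure SG) (u : SG → ℝ) : ℝ := ∫ x, laplacian ζ u x ^ 2 ∂ζ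

/-- `h` is harmonic on `SG`: continuous, and graph harmonic at all points of `V_m \ V_0` for every
level `m` (written weakly: its graph energy with every function vanishing on `V_0` is zero). -/
def IsHarmonic (h : SG → ℝ) : Prop :=
  Continuous h ∧ ∀ (m : ℕ) (v : SG → ℝ), (∀ i, v (q i) = 0) → graphEnergy m h v = 0

/-- The normal derivative of `u` at `F_w q_i`, with respect to the cell `F_w(SG)`, exists and
is `d`: it is `r_w⁻¹ ∂ₙ(u ∘ F_w)(q_i)` with `r_w = (3/5)^|w|` and
`∂ₙ g(q_i) = lim_k (5/3)^k (2 g(q_i) - g(F_i^k q_{i+1}) - g(F_i^k q_{i-1}))`. -/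
def HasNormalDeriv (u : SG → ℝ) {m : ℕ} (w : Fin m → Fin 3) (i : Fin 3) (d : ℝ) : Prop :=
  Tendsto (fun k : ℕ => (5 / 3 : ℝ) ^ m * ((5 / 3 : ℝ) ^ k *
      (2 * u (cellMap w (q i)) - u (cellMap w ((F i)^[k] (q (i + 1))))
        - u (cellMap w ((F i)^[k] (q (i - 1))))))) atTop (𝓝 d)

/-- There are `x₁, x₂, x₃ ∈ E` for which the matrix `(h_j(x_k))` is invertible, where `h_j` is the
harmonic function with `h_j(q_i) = δ_{ij}`. -/
def HarmonicallyNondegenerate (E : Set SG) : Prop :=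
  ∃ h : Fin 3 → SG → ℝ, (∀ j, IsHarmonic (h j)) ∧ (∀ i j, h j (q i) = if i = j then 1 else 0) ∧
    ∃ x : Fin 3 → SG, (∀ k, x k ∈ E) ∧ IsUnit (Matrix.of fun k j => h j (x k))

/-- The admissible functions: `u ∈ dom_{L²} Δ_ζ` with `u(x) = a(x)` and `∂ₙ u(x) = b(x)` for
`x ∈ E`, where `c x = (w, i)` says that the normal derivative at `x = F_w q_i` is taken with
respect to the cell `F_w(SG)`. -/
def Admissible (ζ : Measure SG) {m : ℕ} (E : Set SG) (c : SG → (Fin m → Fin 3) × Fin 3)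
    (a b : SG → ℝ) : Set (SG → ℝ) :=
  {u | InDomLaplacian ζ u ∧
    ∀ x ∈ E, u x = a x ∧ HasNormalDeriv u (c x).1 (c x).2 (b x)}

/-- `u` minimizes `T_ζ` over the set `X` of functions. -/
def IsMinimizer (ζ : Measure SG) (X : Set (SG → ℝ)) (u : SG → ℝ) : Prop :=
  u ∈ X ∧ ∀ v ∈ X, T ζ u ≤ T ζ v

/-- `u ∈ dom_{L²} Δ_ζ` is piecewise biharmonic on `m`-cells, and `g` is a representative of
`Δ_ζ u` that is harmonic in the interior of each `m`-cell: `g ∘ F_w` agrees off `V_0` with a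
harmonic function, for all `|w| = m`. (The values of `g` on the `ζ`-null set `V_m` are free.) -/
def IsPiecewiseBiharmonic (ζ : Measure SG) (m : ℕ) (u g : SG → ℝ) : Prop :=
  HasLaplacian ζ u g ∧
    ∀ w : Fin m → Fin 3, ∃ h, IsHarmonic h ∧ ∀ x, x ∉ V 0 → g (cellMap w x) = h x

/-- `g` has matching normal derivatives at `y`: with respect to any two distinct `m`-cells that
meet at `y`, its normal derivatives exist and sum to zero. -/
def HasMatchingNormalDerivs (m : ℕ) (g : SG → ℝ) (y : SG) : Prop :=
  ∀ (w w' : Fin m → Fin 3) (i j : Fin 3), w ≠ w' → cellMap w (q i) = y → cellMap w' (q j) = y →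
    ∃ d, HasNormalDeriv g w i d ∧ HasNormalDeriv g w' j (-d)

/-- `u` is piecewise biharmonic on `m`-cells, and (the representative that is piecewise harmonic
of) `Δ_ζ u` is continuous with matching normal derivatives at each `y ∈ V_m \ E`. At a point of
`V_0 \ E`, which lies in a single `m`-cell, matching means that `Δ_ζ u` and its normal derivative
vanish. -/
def IsBiharmonicAwayFrom (ζ : Measure SG) (m : ℕ) (E : Set SG) (u : SG → ℝ) : Prop :=
  ∃ g, IsPiecewiseBiharmonic ζ m u g ∧
    (∀ y ∈ V m \ E, ContinuousAt g y ∧ HasMatchingNormalDerivs m g y) ∧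
    ∀ y ∈ V 0 \ E, g y = 0 ∧
      ∀ (w : Fin m → Fin 3) (i : Fin 3), cellMap w (q i) = y → HasNormalDeriv g w i 0

end SierpinskiGasket

end

/-!
The proof reduces the variational problem to Hilbert space orthogonality, made explicit by Green's
formula.

**Weak Laplacian at finite level.** Let `interp h n v` be the function that is harmonic in each
`n`-cell and agrees with `v` on `V_n`. Since the energy of a harmonic function is the same at all
levels (`IsHarmonic.graphEnergy_eq`), testing with `interp h n v` turns the weak equation
`Δ_ζ u = f` into the exact identities `E_n(u, v) = -∫ f · interp h n v dζ` for all `n` and all `v`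
vanishing on `V_0`, and these identities are equivalent to it
(`IsHarmonicBasis.graphEnergy_of_hasLaplacian`, `IsHarmonicBasis.hasLaplacian_of_graphEnergy`).
Everything about `Δ_ζ` follows from them: its values are unique almost everywhere, it localizes to
cells, normal derivatives exist and are given by `cellFlux` (`hasNormalDeriv_cellFlux`), they match
at junction points, and functions on the cells with matching data can be glued
(`hasLaplacian_of_cells`). The Dirichlet problem is solved by a series of corrections at successive
levels that decays like `(3/5)^k` (`exists_hasLaplacian_eq`).

**Splines.** On one cell, the Gram matrix of the harmonic functions in `L²` is invertible, so
biharmonic functions with arbitrary values and normal derivatives at the three vertices exist; by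
gluing, so do piecewise biharmonic functions with arbitrary matching data on `V_m`
(`exists_biharmonic_spline`).

**The variational problem.** By Green's second identity on the cells, a piecewise harmonic function
`g` satisfies the matching conditions off `E` if and only if it is orthogonal in `L²(ζ)` to the
Laplacians of all (spline) functions with vanishing values and normal derivatives on `E`
(`MatchesOff.integral_eq_zero`, `matchesOff_of_orthogonal`). Projecting orthogonally in the
finite-dimensional space of piecewise harmonic functions therefore produces an admissible function
that is biharmonic away from `E` (`exists_admissible_isBiharmonicAwayFrom`). If `u` is such a
function and `v` is admissible, then `T(v) = T(u) + T(v - u)`, and `T(v - u) = 0` makes `v - u` a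
harmonic function vanishing on `E`, hence zero by the nondegeneracy of `E`
(`T_le_of_isBiharmonicAwayFrom`). So `u` is the only minimizer, and the only admissible function
that is biharmonic away from `E`.
-/

noncomputable section

namespace SierpinskiGasket

/-! ### Geometry of the gasket -/

theorem contraction_apply (i k : Fin 3) (x : EuclideanSpace ℝ (Fin 3)) :
    contraction i x k = (x k + if k = i then 1 else 0) / 2 := by
  simp only [contraction, vertex, PiLp.smul_apply, PiLp.add_apply, PiLp.single_apply, smul_eq_mul]
  ring

theorem contraction_vertex_self (i : Fin 3) : contraction i (vertex i) = vertex i := by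
  ext k
  rw [contraction_apply]
  simp only [vertex, PiLp.single_apply]
  split_ifs <;> norm_num

theorem continuous_contraction (i : Fin 3) : Continuous (contraction i) := by
  unfold contraction
  fun_prop

/-- In the realization by standard basis vectors the gasket lies in the standard simplex: its
points have nonnegative (barycentric) coordinates that sum to one. -/
theorem gasket_subset_simplex :
    gasket ⊆ {x : EuclideanSpace ℝ (Fin 3) | (∀ k, 0 ≤ x k) ∧ ∑ k, x k = 1} := by
  refine closure_minimal (Set.iUnion_subset fun m => ?_) ?_
  · induction m with
    | zero =>
      rintro _ ⟨i, rfl⟩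
      refine ⟨fun k => ?_, ?_⟩
      · simp only [vertex, PiLp.single_apply]
        split_ifs <;> norm_num
      · simp [vertex]
    | succ m ih =>
      intro x hx
      obtain ⟨i, y, hy, rfl⟩ := Set.mem_iUnion.1 hx
      obtain ⟨h0, h1⟩ := ih hy
      refine ⟨fun k => ?_, ?_⟩
      · rw [contraction_apply]
        have := h0 k
        split_ifs <;> linarith
      · simp only [contraction_apply, ← Finset.sum_div, Finset.sum_add_distrib, h1]
        norm_num
  · refine IsClosed.inter (s₁ := {x : EuclideanSpace ℝ (Fin 3) | ∀ k, 0 ≤ x k}) ?_ ?_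
    · simp only [Set.ofPred_forall]
      exact isClosed_iInter fun k => isClosed_le continuous_const (by fun_prop)
    · exact isClosed_eq (by fun_prop) continuous_const

theorem isCompact_gasket : IsCompact gasket := by
  refine Metric.isCompact_of_isClosed_isBounded isClosed_closure ?_
  refine (Metric.isBounded_closedBall (x := (0 : EuclideanSpace ℝ (Fin 3))) (r := 1)).subset ?_
  intro x hx
  obtain ⟨h0, h1⟩ := gasket_subset_simplex hx
  rw [mem_closedBall_zero_iff, EuclideanSpace.norm_eq, Real.sqrt_le_one]
  refine le_trans (Finset.sum_le_sum fun k _ => ?_) h1.le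
  have hk : x k ≤ 1 := h1 ▸ Finset.single_le_sum (fun k _ => h0 k) (Finset.mem_univ k)
  rw [Real.norm_eq_abs, sq_abs]
  nlinarith [h0 k]

instance : CompactSpace SG := isCompact_iff_compactSpace.1 isCompact_gasket

theorem continuous_F (i : Fin 3) : Continuous (F i) :=
  ((continuous_contraction i).comp continuous_subtype_val).subtype_mk _

theorem F_coord (i k : Fin 3) (x : SG) : (F i x).1 k = (x.1 k + if k = i then 1 else 0) / 2 :=
  contraction_apply i k x.1

theorem q_coord (i k : Fin 3) : (q i).1 k = if k = i then 1 else 0 := by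
  simp [q, vertex, PiLp.single_apply]

theorem SG_ext {x y : SG} (h : ∀ k, x.1 k = y.1 k) : x = y := by
  apply Subtype.ext
  ext k
  exact h k

theorem coord_nonneg (x : SG) (k : Fin 3) : 0 ≤ x.1 k := (gasket_subset_simplex x.2).1 k

theorem coord_sum (x : SG) : x.1 0 + x.1 1 + x.1 2 = 1 := by
  rw [← Fin.sum_univ_three]
  exact (gasket_subset_simplex x.2).2

theorem eq_q_of_one_le_coord {x : SG} {i : Fin 3} (h : 1 ≤ x.1 i) : x = q i := by
  have h0 := coord_nonneg x 0
  have h1 := coord_nonneg x 1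
  have h2 := coord_nonneg x 2
  have hs := coord_sum x
  refine SG_ext fun k => ?_
  rw [q_coord]
  fin_cases i <;> fin_cases k <;> simp at h ⊢ <;> linarith

theorem q_injective : Function.Injective q := by
  intro i j h
  by_contra hij
  have := congrArg (fun x : SG => x.1 i) h
  simp only [q_coord, if_neg hij] at this
  norm_num at this

theorem F_injective (i : Fin 3) : Function.Injective (F i) := by
  intro x y h
  refine SG_ext fun k => ?_
  have := congrArg (fun x : SG => x.1 k) h
  simp only [F_coord] at this
  linarith

theorem F_q_self (i : Fin 3) : F i (q i) = q i := Subtype.ext (contraction_vertex_self i)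

theorem F_q_comm (i j : Fin 3) : F i (q j) = F j (q i) := by
  refine SG_ext fun k => ?_
  simp only [F_coord, q_coord]
  ring

/-- Distinct `1`-cells meet only in the midpoint of their vertices. -/
theorem eq_q_of_F_eq_F {i j : Fin 3} (hij : i ≠ j) {x y : SG} (h : F i x = F j y) :
    x = q j ∧ y = q i := by
  have h1 := congrArg (fun x : SG => x.1 i) h
  have h2 := congrArg (fun x : SG => x.1 j) h
  simp only [F_coord, if_true, if_neg hij, if_neg hij.symm] at h1 h2
  have := coord_nonneg x i
  have := coord_nonneg y j
  exact ⟨eq_q_of_one_le_coord (by linarith), eq_q_of_one_le_coord (by linarith)⟩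

theorem F_eq_q_iff {i j : Fin 3} {x : SG} : F i x = q j ↔ i = j ∧ x = q j := by
  constructor
  · intro h
    have h1 := congrArg (fun x : SG => x.1 j) h
    simp only [F_coord, q_coord, if_true] at h1
    have hx : x.1 j ≤ 1 := by
      have h0 := coord_nonneg x 0
      have h1 := coord_nonneg x 1
      have h2 := coord_nonneg x 2
      have hs := coord_sum x
      fin_cases j <;> simp <;> linarith
    by_cases hij : i = j
    · rw [if_pos hij.symm] at h1
      exact ⟨hij, eq_q_of_one_le_coord (by linarith)⟩
    · rw [if_neg (Ne.symm hij)] at h1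
      linarith
  · rintro ⟨rfl, rfl⟩
    exact F_q_self i

theorem F_q_eq_iff {i j k l : Fin 3} :
    F i (q j) = F k (q l) ↔ (i = k ∧ j = l) ∨ (i = l ∧ j = k) := by
  constructor
  · intro h
    by_cases hik : i = k
    · subst hik
      exact Or.inl ⟨rfl, q_injective (F_injective i h)⟩
    · obtain ⟨h1, h2⟩ := eq_q_of_F_eq_F hik h
      exact Or.inr ⟨(q_injective h2).symm, q_injective h1⟩
  · rintro (⟨rfl, rfl⟩ | ⟨rfl, rfl⟩)
    · rfl
    · exact F_q_comm _ _

theorem q_ne_F_q {i j : Fin 3} (hij : i ≠ j) (k : Fin 3) : q k ≠ F i (q j) := fun hk => by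
  obtain ⟨h1, h2⟩ := F_eq_q_iff.1 hk.symm
  exact hij (h1.trans (q_injective h2).symm)

theorem exists_F_eq (x : SG) : ∃ i y, F i y = x := by
  have hc : gasket ⊆ ⋃ i, contraction i '' gasket := by
    refine closure_minimal (Set.iUnion_subset fun m => ?_) ?_
    · cases m with
      | zero =>
        rintro _ ⟨i, rfl⟩
        exact Set.mem_iUnion.2 ⟨i, vertex i, vertex_mem i, contraction_vertex_self i⟩
      | succ m =>
        intro x hx
        obtain ⟨i, y, hy, rfl⟩ := Set.mem_iUnion.1 hx
        exact Set.mem_iUnion.2 ⟨i, y, subset_closure (Set.mem_iUnion.2 ⟨m, hy⟩), rfl⟩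
    · exact isClosed_iUnion_of_finite fun i =>
        (isCompact_gasket.image (continuous_contraction i)).isClosed
  obtain ⟨i, y, hy, h⟩ := Set.mem_iUnion.1 (hc x.2)
  exact ⟨i, ⟨y, hy⟩, Subtype.ext h⟩

theorem dist_F (i : Fin 3) (x y : SG) : dist (F i x) (F i y) = dist x y / 2 := by
  change dist (contraction i x.1) (contraction i y.1) = dist x.1 y.1 / 2
  unfold contraction
  rw [dist_smul₀, dist_add_right]
  norm_num
  ring

/-! ### Cells and addresses -/

theorem cellMap_cons {m : ℕ} (i : Fin 3) (w : Fin m → Fin 3) (x : SG) :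
    cellMap (Fin.cons i w : Fin (m + 1) → Fin 3) x = F i (cellMap w x) := by
  simp [cellMap]

theorem cellMap_const {m : ℕ} (i : Fin 3) (x : SG) :
    cellMap (fun _ : Fin m => i) x = (F i)^[m] x := by
  induction m with
  | zero => rfl
  | succ m ih =>
    rw [Function.iterate_succ_apply', ← ih]
    rfl

theorem continuous_cellMap {m : ℕ} (w : Fin m → Fin 3) : Continuous (cellMap w) := by
  induction m with
  | zero => exact continuous_id
  | succ m ih => exact (continuous_F _).comp (ih _)

theorem cellMap_injective {m : ℕ} (w : Fin m → Fin 3) : Function.Injective (cellMap w) := by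
  induction m with
  | zero => exact Function.injective_id
  | succ m ih => exact (F_injective _).comp (ih _)

theorem isClosedEmbedding_cellMap {m : ℕ} (w : Fin m → Fin 3) :
    IsClosedEmbedding (cellMap w) :=
  (continuous_cellMap w).isClosedEmbedding (cellMap_injective w)

theorem dist_cellMap {m : ℕ} (w : Fin m → Fin 3) (x y : SG) :
    dist (cellMap w x) (cellMap w y) = (1 / 2) ^ m * dist x y := by
  induction m with
  | zero => simp [cellMap]
  | succ m ih =>
    change dist (F _ _) (F _ _) = _
    rw [dist_F, ih, pow_succ]
    ring

theorem dist_cellMap_le {m : ℕ} (w : Fin m → Fin 3) (x y : SG) :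
    dist (cellMap w x) (cellMap w y) ≤ (1 / 2) ^ m * Metric.diam (Set.univ : Set SG) := by
  rw [dist_cellMap]
  gcongr
  exact Metric.dist_le_diam_of_mem isCompact_univ.isBounded trivial trivial

theorem tendsto_pow_mul_diam :
    Tendsto (fun m : ℕ => (1 / 2 : ℝ) ^ m * Metric.diam (Set.univ : Set SG)) atTop (𝓝 0) := by
  simpa using (tendsto_pow_atTop_nhds_zero_of_lt_one (by norm_num : (0 : ℝ) ≤ 1 / 2)
    (by norm_num)).mul_const (Metric.diam (Set.univ : Set SG))

theorem exists_cellMap_eq (m : ℕ) (x : SG) : ∃ (w : Fin m → Fin 3) (y : SG), cellMap w y = x := by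
  induction m generalizing x with
  | zero => exact ⟨Fin.elim0, x, rfl⟩
  | succ m ih =>
    obtain ⟨i, y, rfl⟩ := exists_F_eq x
    obtain ⟨w, z, rfl⟩ := ih y
    exact ⟨Fin.cons i w, z, cellMap_cons i w z⟩

theorem mem_V_zero {x : SG} : x ∈ V 0 ↔ ∃ i, q i = x :=
  ⟨fun ⟨_, i, h⟩ => ⟨i, h⟩, fun ⟨i, h⟩ => ⟨Fin.elim0, i, h⟩⟩

theorem q_mem_V_zero (i : Fin 3) : q i ∈ V 0 := mem_V_zero.2 ⟨i, rfl⟩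

theorem cellMap_eq_q_iff {m : ℕ} {w : Fin m → Fin 3} {x : SG} {k : Fin 3} :
    cellMap w x = q k ↔ w = (fun _ => k) ∧ x = q k := by
  induction m with
  | zero => simp [cellMap, eq_iff_true_of_subsingleton]
  | succ m ih =>
    change F (w 0) (cellMap (Fin.tail w) x) = q k ↔ _
    rw [F_eq_q_iff, ih]
    constructor
    · rintro ⟨h0, h1, h2⟩
      refine ⟨?_, h2⟩
      rw [← Fin.cons_self_tail w, h0, h1]
      funext j
      exact Fin.cases rfl (fun _ => rfl) j
    · rintro ⟨rfl, rfl⟩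
      exact ⟨rfl, rfl, rfl⟩

theorem V_zero_subset (m : ℕ) : V 0 ⊆ V m := by
  rintro _ ⟨_, i, rfl⟩
  exact ⟨fun _ => i, i, cellMap_eq_q_iff.2 ⟨rfl, rfl⟩⟩

/-- Distinct `m`-cells meet only in vertices of both. -/
theorem mem_V_zero_of_cellMap_eq {m : ℕ} {w w' : Fin m → Fin 3} {x x' : SG} (hw : w ≠ w')
    (h : cellMap w x = cellMap w' x') : x ∈ V 0 ∧ x' ∈ V 0 := by
  induction m with
  | zero => exact absurd (Subsingleton.elim w w') hw
  | succ m ih =>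
    change F (w 0) (cellMap (Fin.tail w) x) = F (w' 0) (cellMap (Fin.tail w') x') at h
    by_cases h0 : w 0 = w' 0
    · rw [h0] at h
      refine ih (fun ht => hw ?_) (F_injective _ h)
      rw [← Fin.cons_self_tail w, ← Fin.cons_self_tail w', h0, ht]
    · obtain ⟨h1, h2⟩ := eq_q_of_F_eq_F h0 h
      rw [(cellMap_eq_q_iff.1 h1).2, (cellMap_eq_q_iff.1 h2).2]
      exact ⟨q_mem_V_zero _, q_mem_V_zero _⟩

/-- A point of a cell that is not one of its vertices has no other address. -/
theorem cellMap_eq_of_notMem {m : ℕ} {w w' : Fin m → Fin 3} {x x' : SG} (hx : x ∉ V 0)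
    (h : cellMap w x = cellMap w' x') : w = w' ∧ x = x' := by
  by_cases hw : w = w'
  · subst hw
    exact ⟨rfl, cellMap_injective w h⟩
  · exact absurd (mem_V_zero_of_cellMap_eq hw h).1 hx

/-- A junction point outside `V_0` is a vertex of a second cell. -/
theorem exists_other_address {m : ℕ} (w : Fin m → Fin 3) (i : Fin 3)
    (h : cellMap w (q i) ∉ V 0) :
    ∃ (w' : Fin m → Fin 3) (i' : Fin 3), w' ≠ w ∧ cellMap w' (q i') = cellMap w (q i) := by
  induction m with
  | zero => exact absurd (q_mem_V_zero i) h
  | succ m ih =>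
    by_cases hy : cellMap (Fin.tail w) (q i) ∈ V 0
    · obtain ⟨k, hk⟩ := mem_V_zero.1 hy
      have hwk : w 0 ≠ k := by
        rintro rfl
        apply h
        change F (w 0) (cellMap (Fin.tail w) (q i)) ∈ V 0
        rw [← hk, F_q_self]
        exact q_mem_V_zero _
      refine ⟨Fin.cons k fun _ => w 0, w 0, fun he => hwk ?_, ?_⟩
      · rw [← he, Fin.cons_zero]
      · rw [cellMap_cons, cellMap_eq_q_iff.2 ⟨rfl, rfl⟩, F_q_comm, hk]
        rfl
    · obtain ⟨w', i', hw, he⟩ := ih (Fin.tail w) hy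
      refine ⟨Fin.cons (w 0) w', i', fun h' => hw ?_, ?_⟩
      · rw [← h', Fin.tail_cons]
      · rw [cellMap_cons, he]
        rfl

/-- A junction point is a vertex of at most two cells. -/
theorem address_eq_or_eq {m : ℕ} {w₁ w₂ w₃ : Fin m → Fin 3} {i₁ i₂ i₃ : Fin 3} (h : w₁ ≠ w₂)
    (h₁₂ : cellMap w₁ (q i₁) = cellMap w₂ (q i₂)) (h₃ : cellMap w₃ (q i₃) = cellMap w₁ (q i₁)) :
    w₃ = w₁ ∨ w₃ = w₂ := by
  induction m with
  | zero => exact Or.inl (Subsingleton.elim _ _)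
  | succ m ih =>
    change F (w₁ 0) (cellMap (Fin.tail w₁) (q i₁)) = F (w₂ 0) (cellMap (Fin.tail w₂) (q i₂)) at h₁₂
    change F (w₃ 0) (cellMap (Fin.tail w₃) (q i₃)) = F (w₁ 0) (cellMap (Fin.tail w₁) (q i₁)) at h₃
    have key : ∀ {w w' : Fin (m + 1) → Fin 3}, w 0 = w' 0 → Fin.tail w = Fin.tail w' → w = w' := by
      intro w w' h0 ht
      rw [← Fin.cons_self_tail w, ← Fin.cons_self_tail w', h0, ht]
    by_cases h0 : w₁ 0 = w₂ 0
    · rw [h0] at h₁₂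
      have ht : Fin.tail w₁ ≠ Fin.tail w₂ := fun ht => h (key h0 ht)
      by_cases h3 : w₃ 0 = w₁ 0
      · rw [h3] at h₃
        exact (ih ht (F_injective _ h₁₂) (F_injective _ h₃)).imp (key h3) (key (h3.trans h0))
      · obtain ⟨-, e⟩ := eq_q_of_F_eq_F h3 h₃
        have e' := (F_injective _ h₁₂).symm.trans e
        exact absurd ((cellMap_eq_q_iff.1 e).1.trans (cellMap_eq_q_iff.1 e').1.symm) ht
    · obtain ⟨e1, e2⟩ := eq_q_of_F_eq_F h0 h₁₂
      by_cases h3 : w₃ 0 = w₁ 0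
      · rw [h3] at h₃
        have e3 := (F_injective _ h₃).trans e1
        exact Or.inl (key h3 ((cellMap_eq_q_iff.1 e3).1.trans (cellMap_eq_q_iff.1 e1).1.symm))
      · obtain ⟨e4, e5⟩ := eq_q_of_F_eq_F h3 h₃
        have h32 : w₃ 0 = w₂ 0 := q_injective (e5.symm.trans e1)
        exact Or.inr (key h32 ((cellMap_eq_q_iff.1 e4).1.trans (cellMap_eq_q_iff.1 e2).1.symm))

theorem iterate_F_q_notMem {i j : Fin 3} (hij : j ≠ i) {k : ℕ} (hk : k ≠ 0) :
    (F i)^[k] (q j) ∉ V 0 := by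
  rw [← cellMap_const]
  intro h
  obtain ⟨l, hl⟩ := mem_V_zero.1 h
  obtain ⟨h1, h2⟩ := cellMap_eq_q_iff.1 hl.symm
  obtain ⟨k, rfl⟩ := Nat.exists_eq_succ_of_ne_zero hk
  have h3 : i = l := congrFun h1 0
  exact hij (by rw [h3, q_injective h2])

theorem iterate_F_q_self (i : Fin 3) (k : ℕ) : (F i)^[k] (q i) = q i :=
  Function.iterate_fixed (F_q_self i) k

theorem tendsto_iterate_F (i : Fin 3) (x : SG) :
    Tendsto (fun k => (F i)^[k] x) atTop (𝓝 (q i)) := by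
  rw [tendsto_iff_dist_tendsto_zero]
  refine squeeze_zero (fun _ => dist_nonneg) (fun k => ?_) tendsto_pow_mul_diam
  conv_lhs => rw [← iterate_F_q_self i k]
  rw [← cellMap_const, ← cellMap_const]
  exact dist_cellMap_le _ _ _

theorem fin_three_add_one_ne (i : Fin 3) : i + 1 ≠ i := by fin_cases i <;> decide

theorem fin_three_sub_one_ne (i : Fin 3) : i - 1 ≠ i := by fin_cases i <;> decide

/-! ### Gluing functions along cells -/

open Classical in
/-- The function on the gasket that is `g w` on the piece parametrized by `φ w`. At a point that
lies in several pieces one of them is chosen, so that the value is the expected one if the `g w`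
agree there. -/
def glue {ι : Type} (φ : ι → SG → SG) (g : ι → SG → ℝ) (x : SG) : ℝ :=
  if hx : ∃ p : ι × SG, φ p.1 p.2 = x then g hx.choose.1 hx.choose.2 else 0

theorem glue_apply {ι : Type} {φ : ι → SG → SG} {g : ι → SG → ℝ} {w : ι} {x : SG}
    (h : ∀ w' x', φ w' x' = φ w x → g w' x' = g w x) : glue φ g (φ w x) = g w x := by
  have hx : ∃ p : ι × SG, φ p.1 p.2 = φ w x := ⟨(w, x), rfl⟩
  rw [glue, dif_pos hx]
  exact h _ _ hx.choose_spec

theorem glue_F {g : Fin 3 → SG → ℝ} (hg : ∀ i j, g i (q j) = g j (q i)) (i : Fin 3) (x : SG) :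
    glue F g (F i x) = g i x := by
  refine glue_apply fun i' x' h => ?_
  by_cases hi : i' = i
  · subst hi
    rw [F_injective _ h]
  · obtain ⟨rfl, rfl⟩ := eq_q_of_F_eq_F hi h
    exact hg _ _

theorem glue_cellMap {m : ℕ} {g : (Fin m → Fin 3) → SG → ℝ}
    (hg : ∀ w w' i j, cellMap w (q i) = cellMap w' (q j) → g w (q i) = g w' (q j))
    (w : Fin m → Fin 3) (x : SG) : glue cellMap g (cellMap w x) = g w x := by
  refine glue_apply fun w' x' h => ?_
  by_cases hw : w' = w
  · subst hw
    rw [cellMap_injective _ h]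
  · obtain ⟨h1, h2⟩ := mem_V_zero_of_cellMap_eq hw h
    obtain ⟨i, rfl⟩ := mem_V_zero.1 h1
    obtain ⟨j, rfl⟩ := mem_V_zero.1 h2
    exact hg _ _ _ _ h

theorem glue_cellMap_of_notMem {m : ℕ} (g : (Fin m → Fin 3) → SG → ℝ)
    (w : Fin m → Fin 3) {x : SG} (hx : x ∉ V 0) : glue cellMap g (cellMap w x) = g w x := by
  refine glue_apply fun w' x' h => ?_
  obtain ⟨rfl, rfl⟩ := cellMap_eq_of_notMem hx h.symm
  rfl

theorem continuous_of_cover {ι : Type} [Finite ι] {φ : ι → SG → SG}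
    (hφ : ∀ i, IsClosedEmbedding (φ i)) (hc : ∀ x, ∃ i y, φ i y = x) {u : SG → ℝ}
    (hu : ∀ i, Continuous fun x => u (φ i x)) : Continuous u := by
  refine continuous_iff_isClosed.2 fun C hC => ?_
  have : u ⁻¹' C = ⋃ i, φ i '' ((fun x => u (φ i x)) ⁻¹' C) := by
    ext x
    simp only [Set.mem_preimage, Set.mem_iUnion, Set.mem_image]
    constructor
    · intro hx
      obtain ⟨i, y, rfl⟩ := hc x
      exact ⟨i, y, hx, rfl⟩
    · rintro ⟨i, y, hy, rfl⟩
      exact hy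
  rw [this]
  exact isClosed_iUnion_of_finite fun i => (hφ i).isClosedMap _ (hC.preimage (hu i))

theorem continuous_of_cellMap {m : ℕ} {u : SG → ℝ}
    (hu : ∀ w : Fin m → Fin 3, Continuous fun x => u (cellMap w x)) : Continuous u :=
  continuous_of_cover isClosedEmbedding_cellMap (exists_cellMap_eq m) hu

/-! ### Graph energies -/

theorem sum_words_succ {M : Type*} [AddCommMonoid M] {m : ℕ} (f : (Fin (m + 1) → Fin 3) → M) :
    ∑ w, f w = ∑ i : Fin 3, ∑ w : Fin m → Fin 3, f (Fin.cons i w) := by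
  rw [← (Fin.consEquiv fun _ : Fin (m + 1) => Fin 3).sum_comp, Fintype.sum_prod_type]
  rfl

theorem graphEnergy_succ (m : ℕ) (u v : SG → ℝ) :
    graphEnergy (m + 1) u v =
      5 / 3 * ∑ i, graphEnergy m (fun x => u (F i x)) fun x => v (F i x) := by
  simp only [graphEnergy, sum_words_succ, cellMap_cons, ← Finset.mul_sum]
  ring

theorem graphEnergy_add_level (m n : ℕ) (u v : SG → ℝ) :
    graphEnergy (m + n) u v = (5 / 3) ^ m * ∑ w : Fin m → Fin 3,
      graphEnergy n (fun x => u (cellMap w x)) fun x => v (cellMap w x) := by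
  induction m generalizing u v with
  | zero => simp [cellMap]
  | succ m ih =>
    rw [Nat.succ_add, graphEnergy_succ, sum_words_succ]
    simp only [ih, cellMap_cons, ← Finset.mul_sum]
    ring

theorem graphEnergy_comm (m : ℕ) (u v : SG → ℝ) : graphEnergy m u v = graphEnergy m v u := by
  simp only [graphEnergy, mul_comm]

theorem graphEnergy_add_left (m : ℕ) (u u' v : SG → ℝ) :
    graphEnergy m (u + u') v = graphEnergy m u v + graphEnergy m u' v := by
  simp only [graphEnergy, ← mul_add, ← Finset.sum_add_distrib, Pi.add_apply]
  congr! 3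
  ring

theorem graphEnergy_smul_left (m : ℕ) (c : ℝ) (u v : SG → ℝ) :
    graphEnergy m (c • u) v = c * graphEnergy m u v := by
  simp only [graphEnergy, Finset.mul_sum, Pi.smul_apply, smul_eq_mul]
  congr! 2
  ring

theorem graphEnergy_sub_left (m : ℕ) (u u' v : SG → ℝ) :
    graphEnergy m (u - u') v = graphEnergy m u v - graphEnergy m u' v := by
  have h := graphEnergy_add_left m (u - u') u' v
  rw [sub_add_cancel] at h
  linarith

theorem graphEnergy_sub_right (m : ℕ) (u v v' : SG → ℝ) :
    graphEnergy m u (v - v') = graphEnergy m u v - graphEnergy m u v' := by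
  simp only [graphEnergy_comm m u, graphEnergy_sub_left]

theorem graphEnergy_congr {m : ℕ} {u u' v v' : SG → ℝ}
    (hu : ∀ (w : Fin m → Fin 3) i, u (cellMap w (q i)) = u' (cellMap w (q i)))
    (hv : ∀ (w : Fin m → Fin 3) i, v (cellMap w (q i)) = v' (cellMap w (q i))) :
    graphEnergy m u v = graphEnergy m u' v' := by
  simp only [graphEnergy, hu, hv]

theorem graphEnergy_self_eq_zero {m : ℕ} {u : SG → ℝ} (h : graphEnergy m u u = 0)
    (w : Fin m → Fin 3) (i : Fin 3) :
    u (cellMap w (q i)) = u (cellMap w (q (i + 1))) := by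
  rw [graphEnergy, mul_eq_zero, or_iff_right (by positivity),
    Finset.sum_eq_zero_iff_of_nonneg fun w _ => Finset.sum_nonneg fun i _ => mul_self_nonneg _] at h
  have h1 := h w (Finset.mem_univ _)
  rw [Finset.sum_eq_zero_iff_of_nonneg fun i _ => mul_self_nonneg _] at h1
  exact sub_eq_zero.1 (mul_self_eq_zero.1 (h1 i (Finset.mem_univ _)))

/-- The normal derivative at `q_i` of the harmonic function with the same boundary values as
`u`. -/
def vertexFlux (u : SG → ℝ) (i : Fin 3) : ℝ := 2 * u (q i) - u (q (i + 1)) - u (q (i - 1))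

theorem graphEnergy_zero (u v : SG → ℝ) :
    graphEnergy 0 u v = ∑ i, vertexFlux u i * v (q i) := by
  have e1 : (1 : Fin 3) + 1 = 2 := rfl
  have e2 : (2 : Fin 3) + 1 = 0 := rfl
  have e3 : (0 : Fin 3) - 1 = 2 := rfl
  have e4 : (1 : Fin 3) - 1 = 0 := rfl
  have e5 : (2 : Fin 3) - 1 = 1 := rfl
  simp only [graphEnergy, vertexFlux, cellMap, Fin.sum_univ_three, Finset.univ_unique,
    Finset.sum_singleton, zero_add, e1, e2, e3, e4, e5]
  ring

theorem graphEnergy_one (u v : SG → ℝ) :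
    graphEnergy 1 u v = 5 / 3 * (
      v (q 0) * (2 * u (q 0) - u (F 0 (q 1)) - u (F 0 (q 2))) +
      v (q 1) * (2 * u (q 1) - u (F 0 (q 1)) - u (F 1 (q 2))) +
      v (q 2) * (2 * u (q 2) - u (F 0 (q 2)) - u (F 1 (q 2))) +
      v (F 0 (q 1)) * (4 * u (F 0 (q 1)) - u (q 0) - u (q 1) - u (F 0 (q 2)) - u (F 1 (q 2))) +
      v (F 0 (q 2)) * (4 * u (F 0 (q 2)) - u (q 0) - u (q 2) - u (F 0 (q 1)) - u (F 1 (q 2))) +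
      v (F 1 (q 2)) * (4 * u (F 1 (q 2)) - u (q 1) - u (q 2) - u (F 0 (q 1)) - u (F 0 (q 2)))) := by
  have e1 : (1 : Fin 3) + 1 = 2 := rfl
  have e2 : (2 : Fin 3) + 1 = 0 := rfl
  have e3 : (0 : Fin 3) - 1 = 2 := rfl
  have e4 : (1 : Fin 3) - 1 = 0 := rfl
  have e5 : (2 : Fin 3) - 1 = 1 := rfl
  rw [graphEnergy_succ]
  simp only [graphEnergy_zero, vertexFlux, Fin.sum_univ_three, zero_add, e1, e2, e3, e4, e5,
    F_q_self, F_q_comm 1 0, F_q_comm 2 0, F_q_comm 2 1]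
  ring

/-! ### Harmonic functions -/

theorem IsHarmonic.add {g h : SG → ℝ} (hg : IsHarmonic g) (hh : IsHarmonic h) :
    IsHarmonic (g + h) :=
  ⟨hg.1.add hh.1, fun m v hv => by
    rw [graphEnergy_add_left, hg.2 m v hv, hh.2 m v hv, add_zero]⟩

theorem IsHarmonic.smul {h : SG → ℝ} (hh : IsHarmonic h) (c : ℝ) : IsHarmonic (c • h) :=
  ⟨hh.1.const_smul c, fun m v hv => by rw [graphEnergy_smul_left, hh.2 m v hv, mul_zero]⟩

theorem IsHarmonic.sub {g h : SG → ℝ} (hg : IsHarmonic g) (hh : IsHarmonic h) :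
    IsHarmonic (g - h) :=
  ⟨hg.1.sub hh.1, fun m v hv => by
    rw [graphEnergy_sub_left, hg.2 m v hv, hh.2 m v hv, sub_zero]⟩

theorem isHarmonic_const (c : ℝ) : IsHarmonic fun _ => c :=
  ⟨continuous_const, fun m v _ => by simp [graphEnergy]⟩

theorem IsHarmonic.comp_F {h : SG → ℝ} (hh : IsHarmonic h) (i : Fin 3) :
    IsHarmonic fun x => h (F i x) := by
  refine ⟨hh.1.comp (continuous_F i), fun m v hv => ?_⟩
  have hg := glue_F (g := fun j => if j = i then v else 0) fun j k => by
    split_ifs <;> simp [hv]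
  have h0 := hh.2 (m + 1) (glue F fun j => if j = i then v else 0) fun j => by
    rw [← F_q_self j, hg]
    split_ifs <;> simp [hv]
  rw [graphEnergy_succ] at h0
  simp only [hg] at h0
  rw [Finset.sum_eq_single i] at h0
  · rw [if_pos rfl] at h0
    linarith
  · intro j _ hj
    simp [if_neg hj, graphEnergy]
  · simp

theorem IsHarmonic.comp_cellMap {h : SG → ℝ} (hh : IsHarmonic h) {m : ℕ} (w : Fin m → Fin 3) :
    IsHarmonic fun x => h (cellMap w x) := by
  induction m generalizing h with
  | zero => exact hh
  | succ m ih => exact ih (hh.comp_F (w 0)) (Fin.tail w)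

theorem IsHarmonic.eq_zero {h : SG → ℝ} (hh : IsHarmonic h) (h0 : ∀ i, h (q i) = 0) : h = 0 := by
  have key : ∀ (m : ℕ) (w : Fin m → Fin 3) (i : Fin 3), h (cellMap w (q i)) = 0 := by
    intro m
    induction m generalizing h with
    | zero => exact fun w i => h0 i
    | succ m ih =>
      intro w i
      refine ih (hh.comp_F (w 0)) (fun j => ?_) (Fin.tail w) i
      -- `h` has zero energy at level `1`, so it is constant on each triangle `F_i V_0`.
      have hc := graphEnergy_self_eq_zero (hh.2 1 h h0) fun _ => w 0
      simp only [cellMap_const, Function.iterate_one] at hc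
      have hz : h (F (w 0) (q (w 0))) = 0 := by rw [F_q_self, h0]
      have c0 := hc 0
      have c1 := hc 1
      have c2 := hc 2
      have e1 : (1 : Fin 3) + 1 = 2 := rfl
      have e2 : (2 : Fin 3) + 1 = 0 := rfl
      rw [zero_add] at c0
      rw [e1] at c1
      rw [e2] at c2
      generalize w 0 = k at hz c0 c1 c2
      fin_cases k <;> fin_cases j <;> simp at hz c0 c1 c2 ⊢ <;> linarith
  funext x
  choose w y hy using fun m => exists_cellMap_eq m x
  have hlim : Tendsto (fun m => cellMap (w m) (q 0)) atTop (𝓝 x) := by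
    rw [tendsto_iff_dist_tendsto_zero]
    refine squeeze_zero (fun _ => dist_nonneg) (fun m => ?_) tendsto_pow_mul_diam
    conv_lhs => rw [← hy m]
    exact dist_cellMap_le _ _ _
  have := (hh.1.tendsto x).comp hlim
  simp only [Function.comp_def, key] at this
  exact tendsto_nhds_unique this tendsto_const_nhds

theorem IsHarmonic.ext {g h : SG → ℝ} (hg : IsHarmonic g) (hh : IsHarmonic h)
    (he : ∀ i, g (q i) = h (q i)) : g = h :=
  sub_eq_zero.1 ((hg.sub hh).eq_zero fun i => sub_eq_zero.2 (he i))

/-- The renormalization identity: the energy of a harmonic function does not change from level `0`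
to level `1`. -/
theorem IsHarmonic.graphEnergy_one {h : SG → ℝ} (hh : IsHarmonic h) (v : SG → ℝ) :
    graphEnergy 1 h v = graphEnergy 0 h v := by
  classical
  have key : ∀ p : SG, (∀ i, q i ≠ p) → graphEnergy 1 h (fun x => if x = p then 1 else 0) = 0 :=
    fun p hp => hh.2 1 _ fun i => if_neg (hp i)
  have k1 := key (F 0 (q 1)) (q_ne_F_q (by decide))
  have k2 := key (F 0 (q 2)) (q_ne_F_q (by decide))
  have k3 := key (F 1 (q 2)) (q_ne_F_q (by decide))
  simp only [SierpinskiGasket.graphEnergy_one, F_q_eq_iff, q_ne_F_q (show (0 : Fin 3) ≠ 1 by decide),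
    q_ne_F_q (show (0 : Fin 3) ≠ 2 by decide), q_ne_F_q (show (1 : Fin 3) ≠ 2 by decide)] at k1 k2 k3
  norm_num [show (2 : Fin 3) ≠ 1 by decide, show (2 : Fin 3) ≠ 0 by decide,
    show (1 : Fin 3) ≠ 2 by decide, show (0 : Fin 3) ≠ 2 by decide] at k1 k2 k3
  have e1 : (1 : Fin 3) + 1 = 2 := rfl
  have e2 : (2 : Fin 3) + 1 = 0 := rfl
  have e3 : (0 : Fin 3) - 1 = 2 := rfl
  have e4 : (1 : Fin 3) - 1 = 0 := rfl
  have e5 : (2 : Fin 3) - 1 = 1 := rfl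
  have x1 : h (F 0 (q 1)) = (2 * h (q 0) + 2 * h (q 1) + h (q 2)) / 5 := by linarith
  have x2 : h (F 0 (q 2)) = (2 * h (q 0) + 2 * h (q 2) + h (q 1)) / 5 := by linarith
  have x3 : h (F 1 (q 2)) = (2 * h (q 1) + 2 * h (q 2) + h (q 0)) / 5 := by linarith
  simp only [SierpinskiGasket.graphEnergy_one, graphEnergy_zero, vertexFlux, Fin.sum_univ_three,
    zero_add, e1, e2, e3, e4, e5, x1, x2, x3]
  ring

theorem IsHarmonic.graphEnergy_eq {h : SG → ℝ} (hh : IsHarmonic h) (m : ℕ) (v : SG → ℝ) :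
    graphEnergy m h v = graphEnergy 0 h v := by
  induction m generalizing h v with
  | zero => rfl
  | succ m ih =>
    rw [graphEnergy_succ, ← hh.graphEnergy_one, graphEnergy_succ]
    simp only [ih (hh.comp_F _)]

/-- The functions `h_j` are the harmonic functions with `h_j(q_i) = δ_{ij}`. -/
structure IsHarmonicBasis (h : Fin 3 → SG → ℝ) : Prop where
  harmonic : ∀ j, IsHarmonic (h j)
  apply_q : ∀ i j, h j (q i) = if i = j then 1 else 0

/-- The linear combination `∑ a_j h_j`; if `h` is the harmonic basis, it is the harmonic function
with boundary values `a`. -/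
def harmonicExt (h : Fin 3 → SG → ℝ) (a : Fin 3 → ℝ) (x : SG) : ℝ := ∑ j, a j * h j x

theorem harmonicExt_add (h : Fin 3 → SG → ℝ) (a b : Fin 3 → ℝ) :
    harmonicExt h (a + b) = harmonicExt h a + harmonicExt h b := by
  funext x
  simp [harmonicExt, add_mul, Finset.sum_add_distrib]

theorem harmonicExt_smul (h : Fin 3 → SG → ℝ) (c : ℝ) (a : Fin 3 → ℝ) :
    harmonicExt h (c • a) = c • harmonicExt h a := by
  funext x
  simp [harmonicExt, mul_assoc, Finset.mul_sum]

theorem harmonicExt_sub (h : Fin 3 → SG → ℝ) (a b : Fin 3 → ℝ) :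
    harmonicExt h (a - b) = harmonicExt h a - harmonicExt h b := by
  funext x
  simp [harmonicExt, sub_mul, Finset.sum_sub_distrib]

namespace IsHarmonicBasis

variable {h : Fin 3 → SG → ℝ} (hh : IsHarmonicBasis h)
include hh

theorem harmonicExt_q (a : Fin 3 → ℝ) (i : Fin 3) : harmonicExt h a (q i) = a i := by
  simp [harmonicExt, hh.apply_q]

theorem isHarmonic_harmonicExt (a : Fin 3 → ℝ) : IsHarmonic (harmonicExt h a) := by
  have : harmonicExt h a = a 0 • h 0 + a 1 • h 1 + a 2 • h 2 := by
    funext x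
    simp [harmonicExt, Fin.sum_univ_three]
  rw [this]
  exact (((hh.harmonic 0).smul _).add ((hh.harmonic 1).smul _)).add ((hh.harmonic 2).smul _)

theorem eq_harmonicExt {g : SG → ℝ} (hg : IsHarmonic g) :
    g = harmonicExt h fun i => g (q i) :=
  hg.ext (hh.isHarmonic_harmonicExt _) fun i =>
    (hh.harmonicExt_q (fun i => g (q i)) i).symm

theorem harmonicExt_const (c : ℝ) (x : SG) : harmonicExt h (fun _ => c) x = c :=
  (congrFun (hh.eq_harmonicExt (isHarmonic_const c)) x).symm

/-- A bound for `∑ |h_j|`; in fact `1` would do, but any constant serves. -/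
theorem exists_bound : ∃ C : ℝ, 0 ≤ C ∧ ∀ (a : Fin 3 → ℝ) (ε : ℝ), (∀ i, |a i| ≤ ε) →
    ∀ x, |harmonicExt h a x| ≤ C * ε := by
  have hb : ∀ j, ∃ C, ∀ x, |h j x| ≤ C := fun j => by
    obtain ⟨C, hC⟩ := isCompact_univ.exists_bound_of_continuousOn (hh.harmonic j).1.continuousOn
    exact ⟨C, fun x => hC x trivial⟩
  choose C hC using hb
  have hC0 : ∀ j, 0 ≤ C j := fun j => (abs_nonneg _).trans (hC j (q 0))
  refine ⟨∑ j, C j, Finset.sum_nonneg fun j _ => hC0 j, fun a ε ha x => ?_⟩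
  rw [Finset.sum_mul]
  refine (Finset.abs_sum_le_sum_abs _ _).trans (Finset.sum_le_sum fun j _ => ?_)
  rw [abs_mul, mul_comm]
  exact mul_le_mul (hC j x) (ha j) (abs_nonneg _) (hC0 j)

end IsHarmonicBasis

/-! ### Piecewise harmonic interpolation -/

/-- The function that is harmonic in each `m`-cell and agrees with `v` on `V_m`. -/
def interp (h : Fin 3 → SG → ℝ) (m : ℕ) (v : SG → ℝ) : SG → ℝ :=
  glue (cellMap (m := m)) fun w => harmonicExt h fun i => v (cellMap w (q i))

namespace IsHarmonicBasis

variable {h : Fin 3 → SG → ℝ} (hh : IsHarmonicBasis h)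
include hh

theorem interp_cellMap {m : ℕ} (v : SG → ℝ) (w : Fin m → Fin 3) (x : SG) :
    interp h m v (cellMap w x) = harmonicExt h (fun i => v (cellMap w (q i))) x := by
  refine glue_cellMap (fun w w' i j hij => ?_) w x
  rw [hh.harmonicExt_q, hh.harmonicExt_q, hij]

theorem interp_zero (v : SG → ℝ) : interp h 0 v = harmonicExt h fun i => v (q i) :=
  funext fun x => hh.interp_cellMap v Fin.elim0 x

theorem interp_add_cellMap {m n : ℕ} (v : SG → ℝ) (w : Fin m → Fin 3) (x : SG) :
    interp h (m + n) v (cellMap w x) = interp h n (fun y => v (cellMap w y)) x := by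
  induction m generalizing v with
  | zero => simp [cellMap]
  | succ m ih =>
    rw [Nat.succ_add]
    have hs : ∀ y, interp h (m + n + 1) v (F (w 0) y) =
        interp h (m + n) (fun y => v (F (w 0) y)) y := by
      intro y
      obtain ⟨w', z, rfl⟩ := exists_cellMap_eq (m + n) y
      rw [← cellMap_cons, hh.interp_cellMap, hh.interp_cellMap]
      simp only [cellMap_cons]
    exact (hs _).trans (ih (fun y => v (F (w 0) y)) (Fin.tail w))

theorem continuous_interp (m : ℕ) (v : SG → ℝ) : Continuous (interp h m v) := by
  refine continuous_of_cellMap (m := m) fun w => ?_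
  simp only [hh.interp_cellMap]
  exact (hh.isHarmonic_harmonicExt _).1

theorem interp_apply_vertex {m : ℕ} (v : SG → ℝ) (w : Fin m → Fin 3) (i : Fin 3) :
    interp h m v (cellMap w (q i)) = v (cellMap w (q i)) := by
  rw [hh.interp_cellMap, hh.harmonicExt_q]

theorem interp_q (m : ℕ) (v : SG → ℝ) (i : Fin 3) : interp h m v (q i) = v (q i) := by
  have h1 : cellMap (fun _ : Fin m => i) (q i) = q i := cellMap_eq_q_iff.2 ⟨rfl, rfl⟩
  have := hh.interp_apply_vertex v (fun _ : Fin m => i) i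
  rwa [h1] at this

theorem interp_sub (m : ℕ) (v v' : SG → ℝ) :
    interp h m (v - v') = interp h m v - interp h m v' := by
  funext x
  obtain ⟨w, y, rfl⟩ := exists_cellMap_eq m x
  rw [Pi.sub_apply, hh.interp_cellMap, hh.interp_cellMap, hh.interp_cellMap, ← Pi.sub_apply,
    ← harmonicExt_sub]
  rfl

theorem interp_add (m : ℕ) (v v' : SG → ℝ) :
    interp h m (v + v') = interp h m v + interp h m v' := by
  funext x
  obtain ⟨w, y, rfl⟩ := exists_cellMap_eq m x
  rw [Pi.add_apply, hh.interp_cellMap, hh.interp_cellMap, hh.interp_cellMap, ← Pi.add_apply,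
    ← harmonicExt_add]
  rfl

theorem interp_smul (m : ℕ) (c : ℝ) (v : SG → ℝ) : interp h m (c • v) = c • interp h m v := by
  funext x
  obtain ⟨w, y, rfl⟩ := exists_cellMap_eq m x
  rw [Pi.smul_apply, hh.interp_cellMap, hh.interp_cellMap, ← Pi.smul_apply, ← harmonicExt_smul]
  rfl

/-- Interpolation does not change a harmonic function. -/
theorem interp_harmonic (m : ℕ) {g : SG → ℝ} (hg : IsHarmonic g) : interp h m g = g := by
  funext x
  obtain ⟨w, y, rfl⟩ := exists_cellMap_eq m x
  rw [hh.interp_cellMap]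
  exact (congrFun (hh.eq_harmonicExt (hg.comp_cellMap w)) y).symm

/-- The energy pairing with a function that is harmonic in each `n`-cell is that of level `n`. -/
theorem graphEnergy_interp (n k : ℕ) (u v : SG → ℝ) :
    graphEnergy (n + k) u (interp h n v) = graphEnergy n u v := by
  have h0 := graphEnergy_add_level n 0 u v
  rw [add_zero] at h0
  rw [h0, graphEnergy_add_level]
  congr! 2 with w
  simp only [hh.interp_cellMap]
  rw [graphEnergy_comm, (hh.isHarmonic_harmonicExt _).graphEnergy_eq, graphEnergy_comm]
  exact graphEnergy_congr (fun _ _ => rfl) fun _ i => hh.harmonicExt_q _ i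

theorem inDomEnergy_interp (n : ℕ) (v : SG → ℝ) : InDomEnergy (interp h n v) := by
  refine ⟨hh.continuous_interp n v, Tendsto.bddAbove_range (a := graphEnergy n (interp h n v) v) ?_⟩
  refine tendsto_const_nhds.congr' ?_
  filter_upwards [eventually_ge_atTop n] with k hk
  obtain ⟨k, rfl⟩ := Nat.exists_eq_add_of_le hk
  exact (hh.graphEnergy_interp n k _ v).symm

/-- The piecewise harmonic interpolants of a continuous function converge to it uniformly. -/
theorem tendstoUniformly_interp {v : SG → ℝ} (hv : Continuous v) :
    TendstoUniformly (fun n => interp h n v) v atTop := by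
  obtain ⟨C, hC0, hC⟩ := hh.exists_bound
  have huc := CompactSpace.uniformContinuous_of_continuous hv
  rw [Metric.tendstoUniformly_iff]
  intro ε hε
  obtain ⟨δ, hδ, hvδ⟩ := Metric.uniformContinuous_iff.1 huc (ε / (C + 1)) (by positivity)
  filter_upwards [tendsto_pow_mul_diam.eventually (gt_mem_nhds hδ)] with n hn x
  obtain ⟨w, y, rfl⟩ := exists_cellMap_eq n x
  have hd : harmonicExt h (fun i => v (cellMap w (q i)) - v (cellMap w y)) y =
      interp h n v (cellMap w y) - v (cellMap w y) := by
    rw [hh.interp_cellMap]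
    conv_rhs => rw [← hh.harmonicExt_const (v (cellMap w y)) y]
    rw [← Pi.sub_apply, ← harmonicExt_sub]
    rfl
  rw [dist_comm, Real.dist_eq, ← hd]
  refine (hC _ (ε / (C + 1)) (fun i => ?_) y).trans_lt ?_
  · exact (hvδ ((dist_cellMap_le _ _ _).trans_lt hn)).le
  · rw [mul_div_assoc', div_lt_iff₀ (by positivity)]
    nlinarith

end IsHarmonicBasis

/-! ### The measure on cells -/

theorem measurableEmbedding_cellMap {m : ℕ} (w : Fin m → Fin 3) :
    MeasurableEmbedding (cellMap w) :=
  (isClosedEmbedding_cellMap w).measurableEmbedding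

/-- The restriction of `ζ` to the cell `F_w(SG)`, pulled back to the whole gasket. -/
def cellMeasure (ζ : Measure SG) {m : ℕ} (w : Fin m → Fin 3) : Measure SG := ζ.comap (cellMap w)

theorem V_finite (m : ℕ) : (V m).Finite := by
  have : V m = Set.range fun p : (Fin m → Fin 3) × Fin 3 => cellMap p.1 (q p.2) := by
    ext x
    simp [V]
  rw [this]
  exact Set.finite_range _

section
variable (ζ : Measure SG)

instance [IsFiniteMeasure ζ] {m : ℕ} (w : Fin m → Fin 3) : IsFiniteMeasure (cellMeasure ζ w) :=
  inferInstanceAs (IsFiniteMeasure (ζ.comap (cellMap w)))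

instance [NullSingletonClass ζ] {m : ℕ} (w : Fin m → Fin 3) :
    NullSingletonClass (cellMeasure ζ w) where
  measure_singleton x := by
    rw [cellMeasure, (measurableEmbedding_cellMap w).comap_apply, Set.image_singleton,
      measure_singleton]

theorem map_cellMeasure {m : ℕ} (w : Fin m → Fin 3) :
    (cellMeasure ζ w).map (cellMap w) = ζ.restrict (Set.range (cellMap w)) :=
  (measurableEmbedding_cellMap w).map_comap ζ

/-- A nonempty open set contains a point other than the three vertices. -/
theorem exists_notMem_V_zero {U : Set SG} (hU : IsOpen U) (hne : U.Nonempty) :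
    ∃ x ∈ U, x ∉ V 0 := by
  obtain ⟨x, hx⟩ := hne
  by_cases hV : x ∈ V 0
  · obtain ⟨i, rfl⟩ := mem_V_zero.1 hV
    obtain ⟨k, hk, hk0⟩ := (((tendsto_iterate_F i (q (i + 1))).eventually
      (hU.mem_nhds hx)).and (eventually_ne_atTop 0)).exists
    exact ⟨_, hk, iterate_F_q_notMem (fin_three_add_one_ne i) hk0⟩
  · exact ⟨x, hx, hV⟩

instance [ζ.IsOpenPosMeasure] {m : ℕ} (w : Fin m → Fin 3) :
    (cellMeasure ζ w).IsOpenPosMeasure where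
  open_pos U hU hne := by
    rw [cellMeasure, (measurableEmbedding_cellMap w).comap_apply]
    obtain ⟨x, hxU, hxV⟩ := exists_notMem_V_zero hU hne
    -- The image of `U \ V_0` is open: its complement is a finite union of closed sets.
    have hc : (cellMap w '' (U \ V 0))ᶜ =
        cellMap w '' (Uᶜ ∪ V 0) ∪
          ⋃ w' : {w' : Fin m → Fin 3 // w' ≠ w}, Set.range (cellMap w'.1) := by
      ext y
      obtain ⟨w', z, rfl⟩ := exists_cellMap_eq m y
      simp only [Set.mem_compl_iff, Set.mem_union, Set.mem_iUnion]
      constructor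
      · intro h
        by_cases hw : w' = w
        · subst hw
          refine Or.inl ⟨z, ?_, rfl⟩
          by_contra hz
          simp only [Set.mem_union, Set.mem_compl_iff, not_or, not_not] at hz
          exact h ⟨z, hz, rfl⟩
        · exact Or.inr ⟨⟨w', hw⟩, z, rfl⟩
      · rintro h ⟨z', ⟨hz1, hz2⟩, he⟩
        obtain ⟨rfl, rfl⟩ := cellMap_eq_of_notMem hz2 he
        rcases h with ⟨z'', hz'', he'⟩ | ⟨⟨w'', hw''⟩, z'', he'⟩
        · rw [cellMap_injective _ he'] at hz''
          exact hz''.elim (fun h => h hz1) hz2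
        · exact hw'' (cellMap_eq_of_notMem hz2 he'.symm).1.symm
    have ho : IsOpen (cellMap w '' (U \ V 0)) := by
      rw [← isClosed_compl_iff, hc]
      refine IsClosed.union ((isClosedEmbedding_cellMap w).isClosedMap _
        (hU.isClosed_compl.union (V_finite 0).isClosed)) ?_
      exact isClosed_iUnion_of_finite fun w' => (isClosedEmbedding_cellMap _).isClosed_range
    have := ho.measure_ne_zero ζ ⟨_, x, ⟨hxU, hxV⟩, rfl⟩
    exact fun h => this (measure_mono_null (Set.image_mono Set.sdiff_subset) h)

/-- Since cells overlap in finitely many points only, an atomless measure is the sum of its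
restrictions to the cells. -/
theorem sum_map_cellMeasure [NullSingletonClass ζ] (m : ℕ) :
    ∑ w : Fin m → Fin 3, (cellMeasure ζ w).map (cellMap w) = ζ := by
  simp only [map_cellMeasure]
  rw [← Measure.sum_fintype, ← Measure.restrict_iUnion_ae]
  · rw [Set.iUnion_eq_univ_iff.2, Measure.restrict_univ]
    intro x
    obtain ⟨w, y, rfl⟩ := exists_cellMap_eq m x
    exact ⟨w, y, rfl⟩
  · intro w w' hw
    refine measure_mono_null ?_ ((V_finite m).measure_zero ζ)
    rintro x ⟨⟨y, rfl⟩, ⟨z, hz⟩⟩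
    obtain ⟨h, -⟩ := mem_V_zero_of_cellMap_eq hw hz.symm
    obtain ⟨i, rfl⟩ := mem_V_zero.1 h
    exact ⟨w, i, rfl⟩
  · exact fun w => (measurableEmbedding_cellMap w).measurableSet_range.nullMeasurableSet

variable {ζ}

theorem MemLp.comp_cellMap {f : SG → ℝ} (hf : MemLp f 2 ζ) {m : ℕ} (w : Fin m → Fin 3) :
    MemLp (fun x => f (cellMap w x)) 2 (cellMeasure ζ w) := by
  refine (measurableEmbedding_cellMap w).memLp_map_measure_iff.1 ?_
  rw [map_cellMeasure]
  exact hf.restrict _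

theorem integral_eq_sum_cells [NullSingletonClass ζ] {f : SG → ℝ} (hf : Integrable f ζ) (m : ℕ) :
    ∫ x, f x ∂ζ = ∑ w : Fin m → Fin 3, ∫ x, f (cellMap w x) ∂cellMeasure ζ w := by
  conv_lhs => rw [← sum_map_cellMeasure ζ m]
  rw [integral_finsetSum_measure fun w _ => ?_]
  · simp only [(measurableEmbedding_cellMap _).integral_map]
  · rw [map_cellMeasure]
    exact hf.restrict

theorem memLp_of_continuous [IsFiniteMeasure ζ] {v : SG → ℝ} (hv : Continuous v) :
    MemLp v 2 ζ := by
  obtain ⟨C, hC⟩ := isCompact_univ.exists_bound_of_continuousOn hv.continuousOn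
  exact MemLp.of_bound hv.aestronglyMeasurable C (ae_of_all _ fun x => hC x trivial)

theorem integrable_mul_continuous [IsFiniteMeasure ζ] {f v : SG → ℝ} (hf : MemLp f 2 ζ)
    (hv : Continuous v) : Integrable (fun x => f x * v x) ζ :=
  hf.integrable_mul (memLp_of_continuous hv)

end

/-! ### The weak Laplacian in terms of graph energies -/

namespace IsHarmonicBasis

variable {h : Fin 3 → SG → ℝ} (hh : IsHarmonicBasis h) {ζ : Measure SG}
include hh

/-- Testing the weak equation with the function that is harmonic in the `n`-cells gives an exact
identity at level `n`. -/
theorem graphEnergy_of_hasLaplacian {u f v : SG → ℝ} (hu : HasLaplacian ζ u f)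
    (hv : ∀ i, v (q i) = 0) (n : ℕ) :
    graphEnergy n u v = -∫ x, f x * interp h n v x ∂ζ := by
  refine tendsto_nhds_unique ?_ (hu.2.2 _ (hh.inDomEnergy_interp n v) fun i => by
    rw [hh.interp_q, hv])
  refine tendsto_const_nhds.congr' ?_
  filter_upwards [eventually_ge_atTop n] with k hk
  obtain ⟨k, rfl⟩ := Nat.exists_eq_add_of_le hk
  exact (hh.graphEnergy_interp n k u v).symm

variable [IsFiniteMeasure ζ]

theorem exists_interp_bound {v : SG → ℝ} {K : ℝ} (hv : ∀ x, |v x| ≤ K) :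
    ∃ C, ∀ n x, |interp h n v x| ≤ C := by
  obtain ⟨C, -, hC⟩ := hh.exists_bound
  refine ⟨C * K, fun n x => ?_⟩
  obtain ⟨w, y, rfl⟩ := exists_cellMap_eq n x
  rw [hh.interp_cellMap]
  exact hC _ _ (fun i => hv _) y

theorem tendsto_integral_mul_interp_of_tendsto {f v g : SG → ℝ} (hf : MemLp f 2 ζ) {K : ℝ}
    (hv : ∀ x, |v x| ≤ K) (hg : ∀ᵐ x ∂ζ, Tendsto (fun n => interp h n v x) atTop (𝓝 (g x))) :
    Tendsto (fun n => ∫ x, f x * interp h n v x ∂ζ) atTop (𝓝 (∫ x, f x * g x ∂ζ)) := by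
  obtain ⟨C, hC⟩ := hh.exists_interp_bound hv
  refine tendsto_integral_of_dominated_convergence (fun x => ‖f x‖ * C)
    (fun n => (integrable_mul_continuous hf (hh.continuous_interp n v)).aestronglyMeasurable)
    ((hf.integrable one_le_two).norm.mul_const C) (fun n => ae_of_all _ fun x => ?_) ?_
  · rw [norm_mul]
    exact mul_le_mul_of_nonneg_left (hC n x) (norm_nonneg _)
  · filter_upwards [hg] with x hx
    exact hx.const_mul _

theorem tendsto_integral_mul_interp {f v : SG → ℝ} (hf : MemLp f 2 ζ) (hv : Continuous v) :
    Tendsto (fun n => ∫ x, f x * interp h n v x ∂ζ) atTop (𝓝 (∫ x, f x * v x ∂ζ)) := by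
  obtain ⟨C, hC⟩ := isCompact_univ.exists_bound_of_continuousOn hv.continuousOn
  exact hh.tendsto_integral_mul_interp_of_tendsto hf (fun x => hC x trivial)
    (ae_of_all _ fun x => (hh.tendstoUniformly_interp hv).tendsto_at x)

/-- Conversely, these identities at all large levels give the weak equation; in particular the
energy is then finite. -/
theorem hasLaplacian_of_graphEnergy {u f : SG → ℝ} (hu : Continuous u) (hf : MemLp f 2 ζ) (N : ℕ)
    (hE : ∀ n, N ≤ n → ∀ v : SG → ℝ, (∀ i, v (q i) = 0) →
      graphEnergy n u v = -∫ x, f x * interp h n v x ∂ζ) : HasLaplacian ζ u f := by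
  have hlim : ∀ v : SG → ℝ, Continuous v → (∀ i, v (q i) = 0) →
      Tendsto (fun n => graphEnergy n u v) atTop (𝓝 (-∫ x, f x * v x ∂ζ)) := by
    intro v hv h0
    refine (hh.tendsto_integral_mul_interp hf hv).neg.congr' ?_
    filter_upwards [eventually_ge_atTop N] with n hn
    exact (hE n hn v h0).symm
  refine ⟨⟨hu, ?_⟩, hf, fun v hv h0 => hlim v hv.1 h0⟩
  set g := harmonicExt h fun i => u (q i) with hg
  have hgh : IsHarmonic g := hh.isHarmonic_harmonicExt _
  have h1 := hlim (u - g) (hu.sub hgh.1) fun i => by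
    rw [Pi.sub_apply, hg, hh.harmonicExt_q, sub_self]
  refine Tendsto.bddAbove_range ((h1.add_const (graphEnergy 0 g u)).congr fun n => ?_)
  rw [graphEnergy_sub_right, ← hgh.graphEnergy_eq n u, graphEnergy_comm n g u, sub_add_cancel]

end IsHarmonicBasis

theorem HasLaplacian.sub {ζ : Measure SG} [IsFiniteMeasure ζ] {h : Fin 3 → SG → ℝ}
    (hh : IsHarmonicBasis h) {u u' f f' : SG → ℝ}
    (hu : HasLaplacian ζ u f) (hu' : HasLaplacian ζ u' f') : HasLaplacian ζ (u - u') (f - f') := by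
  refine hh.hasLaplacian_of_graphEnergy (hu.1.1.sub hu'.1.1) (hu.2.1.sub hu'.2.1) 0
    fun n _ v hv => ?_
  rw [graphEnergy_sub_left, hh.graphEnergy_of_hasLaplacian hu hv,
    hh.graphEnergy_of_hasLaplacian hu' hv]
  simp only [Pi.sub_apply, sub_mul]
  rw [integral_sub (integrable_mul_continuous hu.2.1 (hh.continuous_interp n v))
    (integrable_mul_continuous hu'.2.1 (hh.continuous_interp n v))]
  ring

theorem HasLaplacian.smul {ζ : Measure SG} [IsFiniteMeasure ζ] {h : Fin 3 → SG → ℝ}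
    (hh : IsHarmonicBasis h) {u f : SG → ℝ} (c : ℝ)
    (hu : HasLaplacian ζ u f) : HasLaplacian ζ (c • u) (c • f) := by
  refine hh.hasLaplacian_of_graphEnergy (hu.1.1.const_smul c) (hu.2.1.const_smul c) 0
    fun n _ v hv => ?_
  rw [graphEnergy_smul_left, hh.graphEnergy_of_hasLaplacian hu hv]
  simp only [Pi.smul_apply, smul_eq_mul, mul_assoc, integral_const_mul, mul_neg]

theorem HasLaplacian.add {ζ : Measure SG} [IsFiniteMeasure ζ] {h : Fin 3 → SG → ℝ}
    (hh : IsHarmonicBasis h) {u u' f f' : SG → ℝ}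
    (hu : HasLaplacian ζ u f) (hu' : HasLaplacian ζ u' f') : HasLaplacian ζ (u + u') (f + f') := by
  have := hu.sub hh (hu'.smul hh (-1))
  simpa using this

theorem HasLaplacian.congr_ae {ζ : Measure SG} {u f f' : SG → ℝ} (hu : HasLaplacian ζ u f)
    (hf : f =ᵐ[ζ] f') : HasLaplacian ζ u f' := by
  refine ⟨hu.1, (memLp_congr_ae hf).1 hu.2.1, fun v hv h0 => ?_⟩
  rw [← integral_congr_ae (f := fun x => f x * v x) (hf.mono fun x hx => by simp only [hx])]
  exact hu.2.2 v hv h0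

theorem IsHarmonic.hasLaplacian {ζ : Measure SG} [IsFiniteMeasure ζ] {h : Fin 3 → SG → ℝ}
    (hh : IsHarmonicBasis h) {g : SG → ℝ} (hg : IsHarmonic g) : HasLaplacian ζ g 0 :=
  hh.hasLaplacian_of_graphEnergy hg.1 MemLp.zero 0 fun n _ v hv => by simp [hg.2 n v hv]

theorem HasLaplacian.isHarmonic {ζ : Measure SG} [IsFiniteMeasure ζ] {h : Fin 3 → SG → ℝ}
    (hh : IsHarmonicBasis h) {u : SG → ℝ} (hu : HasLaplacian ζ u 0) : IsHarmonic u :=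
  ⟨hu.1.1, fun m v hv => by simp [hh.graphEnergy_of_hasLaplacian hu hv]⟩

/-- The Laplacian localizes to cells, with the scaling factors of the energy and of the
measure. -/
theorem HasLaplacian.comp_cellMap {ζ : Measure SG} [IsFiniteMeasure ζ] [NullSingletonClass ζ]
    {h : Fin 3 → SG → ℝ} (hh : IsHarmonicBasis h) {u f : SG → ℝ} (hu : HasLaplacian ζ u f)
    {m : ℕ} (w : Fin m → Fin 3) :
    HasLaplacian (cellMeasure ζ w) (fun x => u (cellMap w x))
      fun x => (3 / 5) ^ m * f (cellMap w x) := by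
  have hf := MemLp.comp_cellMap hu.2.1 w
  refine hh.hasLaplacian_of_graphEnergy (hu.1.1.comp (continuous_cellMap w)) (hf.const_mul _) 0
    fun n _ v hv => ?_
  -- Extend `v` by zero outside the cell.
  set v' := glue (cellMap (m := m)) fun w' => if w' = w then v else 0 with hv'
  have hg : ∀ w' x, v' (cellMap w' x) = (if w' = w then v else 0 : SG → ℝ) x := by
    refine glue_cellMap fun w₁ w₂ i j _ => ?_
    split_ifs <;> simp [hv]
  have h0 : ∀ i, v' (q i) = 0 := fun i => by
    have h1 : cellMap (fun _ : Fin m => i) (q i) = q i := cellMap_eq_q_iff.2 ⟨rfl, rfl⟩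
    rw [← h1, hg]
    split_ifs <;> simp [hv]
  have hE := hh.graphEnergy_of_hasLaplacian hu h0 (m + n)
  rw [graphEnergy_add_level, integral_eq_sum_cells (integrable_mul_continuous hu.2.1
    (hh.continuous_interp _ _)) m] at hE
  simp only [hh.interp_add_cellMap, hg] at hE
  rw [Finset.sum_eq_single w, Finset.sum_eq_single w] at hE
  · simp only [if_true] at hE
    simp only [mul_assoc, integral_const_mul]
    rw [← mul_neg, ← hE, ← mul_assoc, ← mul_pow]
    norm_num
  · intro w' _ hw'
    simp only [if_neg hw', Pi.zero_apply]
    have : interp h n (fun _ => (0 : ℝ)) = fun _ => 0 := hh.interp_harmonic n (isHarmonic_const 0)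
    simp [this]
  · simp
  · intro w' _ hw'
    simp [if_neg hw', graphEnergy]
  · simp

/-! ### Normal derivatives and Green's formula -/

/-- The normal derivative at `F_w q_i`, with respect to the cell `F_w(SG)`, of a function `u` with
Laplacian `f`, as given by Green's formula on that cell. -/
def cellFlux (ζ : Measure SG) (h : Fin 3 → SG → ℝ) (u f : SG → ℝ) {m : ℕ} (w : Fin m → Fin 3)
    (i : Fin 3) : ℝ :=
  (5 / 3) ^ m * vertexFlux (fun x => u (cellMap w x)) i +
    ∫ x, f (cellMap w x) * h i x ∂cellMeasure ζ w

/-- The normal derivative at the vertex `q_i` of a function `u` with Laplacian `f`. -/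
def flux (ζ : Measure SG) (h : Fin 3 → SG → ℝ) (u f : SG → ℝ) (i : Fin 3) : ℝ :=
  vertexFlux u i + ∫ x, f x * h i x ∂ζ

theorem cellFlux_eq (ζ : Measure SG) (h : Fin 3 → SG → ℝ) (u f : SG → ℝ) {m : ℕ}
    (w : Fin m → Fin 3) (i : Fin 3) :
    cellFlux ζ h u f w i = (5 / 3) ^ m * flux (cellMeasure ζ w) h (fun x => u (cellMap w x))
      (fun x => (3 / 5) ^ m * f (cellMap w x)) i := by
  simp only [cellFlux, flux, mul_add, mul_assoc, integral_const_mul]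
  rw [← mul_assoc ((5 / 3 : ℝ) ^ m) ((3 / 5) ^ m), ← mul_pow]
  norm_num

theorem integral_mul_harmonicExt {h : Fin 3 → SG → ℝ} (hh : IsHarmonicBasis h) {ζ : Measure SG}
    [IsFiniteMeasure ζ] {f : SG → ℝ} (hf : MemLp f 2 ζ) (a : Fin 3 → ℝ) :
    ∫ x, f x * harmonicExt h a x ∂ζ = ∑ i, a i * ∫ x, f x * h i x ∂ζ := by
  simp only [harmonicExt, Finset.mul_sum, ← integral_const_mul]
  rw [integral_finsetSum]
  · simp only [mul_left_comm]
  · intro i _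
    simp only [mul_left_comm (f _)]
    exact (integrable_mul_continuous hf (hh.harmonic i).1).const_mul _

section
variable {h : Fin 3 → SG → ℝ} (hh : IsHarmonicBasis h) {ζ : Measure SG} [IsFiniteMeasure ζ]
include hh

/-- **Green's formula** at level `n`. -/
theorem graphEnergy_eq_add_flux {u f : SG → ℝ} (hu : HasLaplacian ζ u f) (n : ℕ) (v : SG → ℝ) :
    graphEnergy n u v = -∫ x, f x * interp h n v x ∂ζ + ∑ i, flux ζ h u f i * v (q i) := by
  set g := harmonicExt h fun i => v (q i) with hg
  have hgh : IsHarmonic g := hh.isHarmonic_harmonicExt _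
  have hgq : ∀ i, g (q i) = v (q i) := fun i => hh.harmonicExt_q _ i
  have h1 := hh.graphEnergy_of_hasLaplacian hu (v := v - g)
    (fun i => by rw [Pi.sub_apply, hgq, sub_self]) n
  rw [graphEnergy_sub_right, hh.interp_sub, hh.interp_harmonic n hgh, graphEnergy_comm n u g,
    hgh.graphEnergy_eq, graphEnergy_comm 0, graphEnergy_zero] at h1
  simp only [Pi.sub_apply, mul_sub] at h1
  rw [integral_sub (integrable_mul_continuous hu.2.1 (hh.continuous_interp n v))
    (integrable_mul_continuous hu.2.1 hgh.1), hg, integral_mul_harmonicExt hh hu.2.1, ← hg] at h1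
  simp only [hgq] at h1
  simp only [flux, add_mul, Finset.sum_add_distrib]
  rw [eq_add_of_sub_eq h1]
  simp only [mul_comm (v (q _))]
  ring

theorem tendsto_flux [NullSingletonClass ζ] {u f : SG → ℝ} (hu : HasLaplacian ζ u f)
    (i : Fin 3) :
    Tendsto (fun k : ℕ => (5 / 3 : ℝ) ^ k *
      (2 * u (q i) - u ((F i)^[k] (q (i + 1))) - u ((F i)^[k] (q (i - 1))))) atTop
      (𝓝 (flux ζ h u f i)) := by
  classical
  -- Green's formula is applied to the interpolants of the indicator function of `q_i`, which are
  -- supported on the cells `F_i^k(SG)`.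
  set v : SG → ℝ := fun x => if x = q i then 1 else 0 with hv
  have hvc : ∀ {k : ℕ} (w : Fin k → Fin 3) (j : Fin 3), v (cellMap w (q j)) =
      if w = (fun _ => i) ∧ j = i then 1 else 0 := by
    intro k w j
    simp only [hv, cellMap_eq_q_iff, q_injective.eq_iff]
  have hE : ∀ k : ℕ, graphEnergy k u v = (5 / 3 : ℝ) ^ k *
      (2 * u (q i) - u ((F i)^[k] (q (i + 1))) - u ((F i)^[k] (q (i - 1)))) := by
    intro k
    have h0 := graphEnergy_add_level k 0 u v
    rw [add_zero] at h0
    rw [h0, Finset.sum_eq_single fun _ => i]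
    · rw [graphEnergy_zero, Finset.sum_eq_single i]
      · have h1 : v (q i) = 1 := if_pos rfl
        simp only [vertexFlux, cellMap_const, iterate_F_q_self, h1, mul_one]
      · intro j _ hj
        simp [hvc, hj]
      · simp
    · intro w _ hw
      rw [graphEnergy_zero]
      simp [hvc, hw]
    · simp
  have hint : Tendsto (fun k => ∫ x, f x * interp h k v x ∂ζ) atTop (𝓝 0) := by
    have hb : ∀ x, |v x| ≤ 1 := fun x => by
      simp only [hv]
      split_ifs <;> simp
    have := hh.tendsto_integral_mul_interp_of_tendsto (g := fun _ => 0) hu.2.1 hb ?_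
    · simpa using this
    have hne : ∀ᵐ x ∂ζ, x ≠ q i := by
      rw [ae_iff]
      simp
    filter_upwards [hne] with x hx
    refine tendsto_const_nhds.congr' ?_
    have hpos : 0 < dist x (q i) := dist_pos.2 hx
    filter_upwards [tendsto_pow_mul_diam.eventually (gt_mem_nhds hpos)] with k hk
    obtain ⟨w, y, rfl⟩ := exists_cellMap_eq k x
    have hw : w ≠ fun _ => i := by
      rintro rfl
      refine absurd hk (not_lt.2 ?_)
      conv_lhs => rw [← iterate_F_q_self i k, ← cellMap_const]
      exact dist_cellMap_le _ _ _
    rw [hh.interp_cellMap]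
    simp [hvc, hw, harmonicExt]
  have hsum : ∑ j, flux ζ h u f j * v (q j) = flux ζ h u f i := by
    rw [Finset.sum_eq_single i]
    · simp [hv]
    · intro j _ hj
      simp [hv, q_injective.eq_iff, hj]
    · simp
  have := hint.neg.add_const (flux ζ h u f i)
  rw [neg_zero, zero_add] at this
  refine this.congr fun k => ?_
  rw [← hE k, graphEnergy_eq_add_flux hh hu, hsum]

theorem hasNormalDeriv_cellFlux [NullSingletonClass ζ] {u f : SG → ℝ} (hu : HasLaplacian ζ u f)
    {m : ℕ} (w : Fin m → Fin 3) (i : Fin 3) :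
    HasNormalDeriv u w i (cellFlux ζ h u f w i) := by
  rw [cellFlux_eq]
  exact (tendsto_flux hh (hu.comp_cellMap hh w) i).const_mul _

theorem eq_cellFlux [NullSingletonClass ζ] {u f : SG → ℝ} (hu : HasLaplacian ζ u f)
    {m : ℕ} {w : Fin m → Fin 3} {i : Fin 3} {d : ℝ} (hd : HasNormalDeriv u w i d) :
    d = cellFlux ζ h u f w i :=
  tendsto_nhds_unique hd (hasNormalDeriv_cellFlux hh hu w i)

/-- The energy at level `m` and the integral against a piecewise harmonic function, both sorted by
cells. -/
theorem sum_cellFlux_mul [NullSingletonClass ζ] {u f : SG → ℝ} (hf : MemLp f 2 ζ) (m : ℕ)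
    (v : SG → ℝ) :
    ∑ w : Fin m → Fin 3, ∑ i, cellFlux ζ h u f w i * v (cellMap w (q i)) =
      graphEnergy m u v + ∫ x, f x * interp h m v x ∂ζ := by
  have h0 := graphEnergy_add_level m 0 u v
  rw [add_zero] at h0
  rw [h0, integral_eq_sum_cells (integrable_mul_continuous hf (hh.continuous_interp m v)) m,
    Finset.mul_sum, ← Finset.sum_add_distrib]
  refine Finset.sum_congr rfl fun w _ => ?_
  simp only [hh.interp_cellMap]
  rw [integral_mul_harmonicExt hh (MemLp.comp_cellMap hf w), graphEnergy_zero, Finset.mul_sum,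
    ← Finset.sum_add_distrib]
  refine Finset.sum_congr rfl fun i _ => ?_
  rw [cellFlux]
  ring

/-- The normal derivatives of a function in the domain of the Laplacian match at all junction
points outside `V_0`: their sum over the cells at such a point is zero. -/
theorem sum_cellFlux_eq_zero [NullSingletonClass ζ] {u f : SG → ℝ} (hu : HasLaplacian ζ u f)
    (m : ℕ) {v : SG → ℝ} (hv : ∀ i, v (q i) = 0) :
    ∑ w : Fin m → Fin 3, ∑ i, cellFlux ζ h u f w i * v (cellMap w (q i)) = 0 := by
  rw [sum_cellFlux_mul hh hu.2.1, hh.graphEnergy_of_hasLaplacian hu hv, neg_add_cancel]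

/-- **Gluing**: functions that have a Laplacian on each `m`-cell and whose normal derivatives match
have a Laplacian on the whole gasket. -/
theorem hasLaplacian_of_cells [NullSingletonClass ζ] {u f : SG → ℝ} {m : ℕ} (hf : MemLp f 2 ζ)
    (hu : ∀ w : Fin m → Fin 3, HasLaplacian (cellMeasure ζ w) (fun x => u (cellMap w x))
      fun x => (3 / 5) ^ m * f (cellMap w x))
    (hm : ∀ v : SG → ℝ, (∀ i, v (q i) = 0) →
      ∑ w : Fin m → Fin 3, ∑ i, cellFlux ζ h u f w i * v (cellMap w (q i)) = 0) :
    HasLaplacian ζ u f := by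
  refine hh.hasLaplacian_of_graphEnergy (continuous_of_cellMap fun w => (hu w).1.1) hf m
    fun n hn v hv => ?_
  obtain ⟨n, rfl⟩ := Nat.exists_eq_add_of_le hn
  rw [graphEnergy_add_level, integral_eq_sum_cells (integrable_mul_continuous hf
    (hh.continuous_interp _ v)) m]
  simp only [graphEnergy_eq_add_flux hh (hu _), hh.interp_add_cellMap, Finset.sum_add_distrib,
    mul_add, mul_assoc, integral_const_mul]
  have h1 := hm v hv
  simp only [cellFlux_eq, mul_assoc, ← Finset.mul_sum] at h1
  rw [h1, add_zero, Finset.sum_neg_distrib, mul_neg, ← Finset.mul_sum, ← mul_assoc, ← mul_pow]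
  norm_num

end

/-! ### Uniqueness of the Laplacian -/

section
variable {h : Fin 3 → SG → ℝ} (hh : IsHarmonicBasis h) {ζ : Measure SG} [IsFiniteMeasure ζ]
include hh

/-- An `L²` function orthogonal to all piecewise harmonic functions that vanish on `V_0` is
zero. -/
theorem ae_eq_zero_of_integral_interp [NullSingletonClass ζ] {f : SG → ℝ} (hf : MemLp f 2 ζ)
    (h0 : ∀ n (v : SG → ℝ), (∀ i, v (q i) = 0) → ∫ x, f x * interp h n v x ∂ζ = 0) :
    f =ᵐ[ζ] 0 := by
  have hc : ∀ v : SG → ℝ, Continuous v → (∀ i, v (q i) = 0) → ∫ x, f x * v x ∂ζ = 0 := by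
    intro v hv hv0
    refine tendsto_nhds_unique (hh.tendsto_integral_mul_interp hf hv) ?_
    simp only [h0 _ v hv0]
    exact tendsto_const_nhds
  refine ae_eq_zero_of_forall_setIntegral_isClosed_eq_zero (hf.integrable one_le_two) fun s hs => ?_
  -- The indicator function of `s` is the limit of continuous functions `φ k` that vanish on `V_0`.
  have hδ : ∀ k : ℕ, (0 : ℝ) < 1 / ((k : ℝ) + 1) := fun k => Nat.one_div_pos_of_nat
  set φ : ℕ → SG → ℝ := fun k x =>
    (thickenedIndicator (hδ k) s x : ℝ) * min 1 (k * Metric.infDist x (V 0)) with hφ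
  have hφc : ∀ k, Continuous (φ k) := fun k =>
    (NNReal.continuous_coe.comp (thickenedIndicator (hδ k) s).continuous).mul
      (continuous_const.min (continuous_const.mul (Metric.continuous_infDist_pt _)))
  have hφ0 : ∀ k i, φ k (q i) = 0 := fun k i => by
    simp [hφ, Metric.infDist_zero_of_mem (q_mem_V_zero i)]
  have hφb : ∀ k x, ‖φ k x‖ ≤ 1 := fun k x => by
    have h1 : (thickenedIndicator (hδ k) s x : ℝ) ≤ 1 := by
      exact_mod_cast thickenedIndicator_le_one (hδ k) s x
    have h2 : 0 ≤ min 1 (k * Metric.infDist x (V 0)) :=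
      le_min zero_le_one (mul_nonneg (Nat.cast_nonneg _) Metric.infDist_nonneg)
    rw [Real.norm_of_nonneg (mul_nonneg (NNReal.coe_nonneg _) h2)]
    exact mul_le_one₀ h1 h2 (min_le_left _ _)
  have hlim : Tendsto (fun k => ∫ x, f x * φ k x ∂ζ) atTop
      (𝓝 (∫ x, f x * s.indicator (fun _ => 1) x ∂ζ)) := by
    refine tendsto_integral_of_dominated_convergence (fun x => ‖f x‖)
      (fun k => (integrable_mul_continuous hf (hφc k)).aestronglyMeasurable)
      (hf.integrable one_le_two).norm (fun k => ae_of_all _ fun x => ?_) ?_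
    · rw [norm_mul]
      exact mul_le_of_le_one_right (norm_nonneg _) (hφb k x)
    · have hV : ∀ᵐ x ∂ζ, x ∉ V 0 := by
        rw [ae_iff]
        simp only [not_not]
        exact (V_finite 0).measure_zero ζ
      filter_upwards [hV] with x hx
      refine Tendsto.const_mul _ ?_
      have hpos : 0 < Metric.infDist x (V 0) :=
        ((V_finite 0).isClosed.notMem_iff_infDist_pos ⟨_, q_mem_V_zero 0⟩).1 hx
      have h1 := tendsto_pi_nhds.1 (thickenedIndicator_tendsto_indicator_closure hδ
        tendsto_one_div_add_atTop_nhds_zero_nat s) x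
      rw [hs.closure_eq] at h1
      have h2 : Tendsto (fun k : ℕ => min 1 (k * Metric.infDist x (V 0))) atTop (𝓝 1) := by
        refine tendsto_const_nhds.congr' ?_
        filter_upwards [(tendsto_natCast_atTop_atTop.atTop_mul_const hpos).eventually_ge_atTop 1]
          with k hk
        exact (min_eq_left hk).symm
      have h3 := ((NNReal.continuous_coe.tendsto _).comp h1).mul h2
      rw [mul_one] at h3
      have h4 : ((s.indicator (fun _ => (1 : NNReal)) x : NNReal) : ℝ) =
          s.indicator (fun _ => (1 : ℝ)) x := by
        by_cases hxs : x ∈ s <;> simp [hxs]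
      rw [← h4]
      exact h3
  have hz := tendsto_nhds_unique hlim (by
    simp only [hc _ (hφc _) (hφ0 _)]
    exact tendsto_const_nhds)
  rw [← integral_indicator hs.measurableSet, ← hz]
  refine integral_congr_ae (ae_of_all _ fun x => ?_)
  by_cases hxs : x ∈ s
  · simp [hxs]
  · simp [hxs]

theorem HasLaplacian.ae_eq [NullSingletonClass ζ] {u f f' : SG → ℝ} (hu : HasLaplacian ζ u f)
    (hu' : HasLaplacian ζ u f') : f =ᵐ[ζ] f' := by
  have hd := hu.sub hh hu'
  rw [sub_self] at hd
  have := ae_eq_zero_of_integral_interp hh hd.2.1 fun n v hv => by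
    have := hh.graphEnergy_of_hasLaplacian hd hv n
    have h0 : graphEnergy n 0 v = 0 := by simp [graphEnergy]
    linarith
  filter_upwards [this] with x hx
  exact sub_eq_zero.1 hx

theorem T_eq [NullSingletonClass ζ] {u f : SG → ℝ} (hu : HasLaplacian ζ u f) :
    T ζ u = ∫ x, f x ^ 2 ∂ζ := by
  have hd : InDomLaplacian ζ u := ⟨f, hu⟩
  have hl : HasLaplacian ζ u (laplacian ζ u) := by
    rw [laplacian, dif_pos hd]
    exact hd.choose_spec
  refine integral_congr_ae ?_
  filter_upwards [HasLaplacian.ae_eq hh hl hu] with x hx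
  rw [hx]

end

/-! ### The Dirichlet problem for the Laplacian -/

theorem V_subset_add (n k : ℕ) : V n ⊆ V (n + k) := by
  induction n with
  | zero => exact V_zero_subset _
  | succ n ih =>
    rintro _ ⟨w, i, rfl⟩
    obtain ⟨w', j, hw'⟩ := ih ⟨Fin.tail w, i, rfl⟩
    rw [Nat.succ_add]
    refine ⟨Fin.cons (w 0) w', j, ?_⟩
    rw [cellMap_cons, hw']
    rfl

theorem graphEnergy_sum_left (m n : ℕ) (D : ℕ → SG → ℝ) (v : SG → ℝ) :
    graphEnergy m (fun x => ∑ k ∈ Finset.range n, D k x) v =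
      ∑ k ∈ Finset.range n, graphEnergy m (D k) v := by
  induction n with
  | zero => simp [graphEnergy]
  | succ n ih =>
    simp only [Finset.sum_range_succ]
    rw [← ih, ← graphEnergy_add_left]
    rfl

theorem integral_abs_cellMap_le {ζ : Measure SG} {f : SG → ℝ} (hf : Integrable f ζ) {m : ℕ}
    (w : Fin m → Fin 3) : ∫ x, |f (cellMap w x)| ∂cellMeasure ζ w ≤ ∫ x, |f x| ∂ζ := by
  rw [← (measurableEmbedding_cellMap w).integral_map (μ := cellMeasure ζ w) fun x => |f x|,
    map_cellMeasure]
  exact setIntegral_le_integral hf.abs (ae_of_all _ fun x => abs_nonneg _)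

section
variable {h : Fin 3 → SG → ℝ} (hh : IsHarmonicBasis h)
include hh

theorem interp_congr {m : ℕ} {v v' : SG → ℝ}
    (hv : ∀ (w : Fin m → Fin 3) i, v (cellMap w (q i)) = v' (cellMap w (q i))) :
    interp h m v = interp h m v' := by
  funext x
  obtain ⟨w, y, rfl⟩ := exists_cellMap_eq m x
  rw [hh.interp_cellMap, hh.interp_cellMap]
  simp only [hv]

/-- The discrete Dirichlet problem at level `1`, with a bound for its solution. -/
theorem exists_correction : ∃ C : ℝ, 0 ≤ C ∧ ∀ (ζ : Measure SG) [IsFiniteMeasure ζ] (f : SG → ℝ),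
    MemLp f 2 ζ → ∃ d : SG → ℝ, (∀ i, d (q i) = 0) ∧
      (∀ x, |interp h 1 d x| ≤ C * ∫ x, |f x| ∂ζ) ∧
      ∀ v : SG → ℝ, (∀ i, v (q i) = 0) →
        graphEnergy 1 d v = -∫ x, f x * interp h 1 v x ∂ζ := by
  classical
  obtain ⟨C, hC0, hC⟩ := hh.exists_bound
  refine ⟨C * C, by positivity, fun ζ _ f hf => ?_⟩
  set e : SG → SG → ℝ := fun p x => if x = p then 1 else 0 with he
  set I := ∫ x, |f x| ∂ζ with hI
  have hI0 : 0 ≤ I := integral_nonneg fun x => abs_nonneg _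
  have hint : ∀ v, Integrable (fun x => f x * interp h 1 v x) ζ := fun v =>
    integrable_mul_continuous hf (hh.continuous_interp 1 v)
  set b : SG → ℝ := fun p => ∫ x, f x * interp h 1 (e p) x ∂ζ with hb
  have hbb : ∀ p, |b p| ≤ C * I := by
    intro p
    rw [hI, ← integral_const_mul]
    refine (abs_integral_le_integral_abs).trans (integral_mono (hint _).abs
      ((hf.integrable one_le_two).abs.const_mul C) fun x => ?_)
    obtain ⟨w, y, rfl⟩ := exists_cellMap_eq 1 x
    simp only [abs_mul, hh.interp_cellMap]
    rw [mul_comm]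
    gcongr
    have := hC (fun i => e p (cellMap w (q i))) 1 (fun i => by
      simp only [he]
      split_ifs <;> simp) y
    rwa [mul_one] at this
  have n01 := q_ne_F_q (show (0 : Fin 3) ≠ 1 by decide)
  have n02 := q_ne_F_q (show (0 : Fin 3) ≠ 2 by decide)
  have n12 := q_ne_F_q (show (1 : Fin 3) ≠ 2 by decide)
  have hne1 : F 0 (q 1) ≠ F 0 (q 2) := fun h => absurd (F_q_eq_iff.1 h) (by decide)
  have hne2 : F 0 (q 1) ≠ F 1 (q 2) := fun h => absurd (F_q_eq_iff.1 h) (by decide)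
  have hne3 : F 0 (q 2) ≠ F 1 (q 2) := fun h => absurd (F_q_eq_iff.1 h) (by decide)
  generalize hp01 : F 0 (q 1) = p01 at *
  generalize hp02 : F 0 (q 2) = p02 at *
  generalize hp12 : F 1 (q 2) = p12 at *
  -- A function vanishing on `V_0` is, on `V_1`, a combination of the three indicator functions.
  have hdec : ∀ v : SG → ℝ, (∀ i, v (q i) = 0) → ∀ (w : Fin 1 → Fin 3) i,
      v (cellMap w (q i)) = (v p01 • e p01 + v p02 • e p02 + v p12 • e p12) (cellMap w (q i)) := by
    intro v hv w i
    change v (F (w 0) (q i)) = (v p01 • e p01 + v p02 • e p02 + v p12 • e p12) (F (w 0) (q i))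
    generalize w 0 = j
    fin_cases j <;> fin_cases i <;>
      simp [he, F_q_self, F_q_comm 1 0, F_q_comm 2 0, F_q_comm 2 1, hp01, hp02, hp12, hv,
        n01, n02, n12, hne1, hne2, hne3, hne1.symm, hne2.symm, hne3.symm]
  -- The coefficients come from the inverse of the matrix with `4` on and `-1` off the diagonal.
  set c01 := -(3 / 50) * (3 * b p01 + b p02 + b p12) with hc01
  set c02 := -(3 / 50) * (3 * b p02 + b p01 + b p12) with hc02
  set c12 := -(3 / 50) * (3 * b p12 + b p01 + b p02) with hc12
  have hcb : ∀ {x y z : ℝ}, |x| ≤ C * I → |y| ≤ C * I → |z| ≤ C * I →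
      |-(3 / 50) * (3 * x + y + z)| ≤ C * I := by
    intro x y z hx hy hz
    rw [abs_le] at *
    constructor <;> linarith
  set d : SG → ℝ := c01 • e p01 + c02 • e p02 + c12 • e p12 with hd
  have hdq : ∀ i, d (q i) = 0 := fun i => by simp [hd, he, n01, n02, n12]
  have hd01 : d p01 = c01 := by simp [hd, he, hne1, hne2]
  have hd02 : d p02 = c02 := by simp [hd, he, hne1.symm, hne3]
  have hd12 : d p12 = c12 := by simp [hd, he, hne2.symm, hne3.symm]
  refine ⟨d, hdq, fun x => ?_, fun v hv => ?_⟩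
  · obtain ⟨w, y, rfl⟩ := exists_cellMap_eq 1 x
    rw [hh.interp_cellMap, mul_assoc]
    refine hC _ (C * I) (fun i => ?_) y
    change |d (F (w 0) (q i))| ≤ _
    have hz : (0 : ℝ) ≤ C * I := by positivity
    have h1 : |c01| ≤ C * I := hcb (hbb _) (hbb _) (hbb _)
    have h2 : |c02| ≤ C * I := hcb (hbb _) (hbb _) (hbb _)
    have h3 : |c12| ≤ C * I := hcb (hbb _) (hbb _) (hbb _)
    generalize w 0 = j
    fin_cases j <;> fin_cases i <;>
      simp [F_q_self, F_q_comm 1 0, F_q_comm 2 0, F_q_comm 2 1, hp01, hp02, hp12, hdq, hd01, hd02,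
        hd12, hz, h1, h2, h3]
  · rw [interp_congr hh (hdec v hv), hh.interp_add, hh.interp_add, hh.interp_smul, hh.interp_smul,
      hh.interp_smul, graphEnergy_one, hp01, hp02, hp12, hd01, hd02, hd12]
    simp only [hv, hdq, Pi.add_apply, Pi.smul_apply, smul_eq_mul, mul_add,
      mul_left_comm (f _)]
    rw [integral_add (f := fun x => v p01 * (f x * interp h 1 (e p01) x) +
        v p02 * (f x * interp h 1 (e p02) x))
      (((hint _).const_mul _).add ((hint _).const_mul _)) ((hint _).const_mul _),
      integral_add ((hint _).const_mul _) ((hint _).const_mul _), integral_const_mul,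
      integral_const_mul, integral_const_mul]
    change _ = -(v p01 * b p01 + v p02 * b p02 + v p12 * b p12)
    rw [hc01, hc02, hc12]
    ring

/-- **The Dirichlet problem** `Δ_ζ u = f`, `u|_{V_0} = 0` is solvable in `L²`. The solution is the
sum over `k` of functions `D k` that are harmonic in the `(k + 1)`-cells, vanish on `V_k`, and solve
the discrete problem in each `k`-cell. -/
theorem exists_hasLaplacian_eq {ζ : Measure SG} [IsFiniteMeasure ζ] [NullSingletonClass ζ]
    {f : SG → ℝ} (hf : MemLp f 2 ζ) : ∃ u, HasLaplacian ζ u f ∧ ∀ i, u (q i) = 0 := by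
  obtain ⟨C, hC0, hC⟩ := exists_correction hh
  have hfw : ∀ (k : ℕ) (w : Fin k → Fin 3),
      MemLp (fun x => (3 / 5) ^ k * f (cellMap w x)) 2 (cellMeasure ζ w) := fun k w =>
    (MemLp.comp_cellMap hf w).const_mul _
  choose d hd0 hdb hdE using fun (k : ℕ) (w : Fin k → Fin 3) => hC (cellMeasure ζ w) _ (hfw k w)
  set D : ℕ → SG → ℝ := fun k => glue (cellMap (m := k)) fun w => interp h 1 (d k w) with hD
  have hDc : ∀ k (w : Fin k → Fin 3) x, D k (cellMap w x) = interp h 1 (d k w) x := fun k =>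
    glue_cellMap fun w w' i j _ => by rw [hh.interp_q, hh.interp_q, hd0, hd0]
  set B := C * ∫ x, |f x| ∂ζ with hB
  have hDb : ∀ k x, ‖D k x‖ ≤ B * (3 / 5) ^ k := by
    intro k x
    obtain ⟨w, y, rfl⟩ := exists_cellMap_eq k x
    rw [hDc]
    refine (hdb k w y).trans ?_
    simp only [abs_mul, abs_of_nonneg (show (0 : ℝ) ≤ (3 / 5) ^ k by positivity),
      integral_const_mul]
    rw [mul_left_comm, mul_comm]
    gcongr
    exact mul_le_mul_of_nonneg_left (integral_abs_cellMap_le (hf.integrable one_le_two) w) hC0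
  have hsum : Summable fun k : ℕ => B * (3 / 5 : ℝ) ^ k :=
    (summable_geometric_of_lt_one (by norm_num) (by norm_num)).mul_left B
  have hDcont : ∀ k, Continuous (D k) := fun k => continuous_of_cellMap (m := k) fun w => by
    simp only [hDc]
    exact hh.continuous_interp 1 _
  have hDV : ∀ n k, n ≤ k → ∀ x ∈ V n, D k x = 0 := by
    intro n k hnk x hx
    obtain ⟨j, rfl⟩ := Nat.exists_eq_add_of_le hnk
    obtain ⟨w, i, rfl⟩ := V_subset_add n j hx
    rw [hDc, hh.interp_q, hd0]
  have hDi : ∀ k, interp h (k + 1) (D k) = D k := by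
    intro k
    funext x
    obtain ⟨w, y, rfl⟩ := exists_cellMap_eq k x
    rw [hh.interp_add_cellMap, hDc]
    refine congrFun (interp_congr hh fun w' i => ?_) y
    rw [hDc, hh.interp_apply_vertex]
  have hDE : ∀ k v, graphEnergy (k + 1) (D k) v =
      -(∫ x, f x * interp h (k + 1) v x ∂ζ - ∫ x, f x * interp h k v x ∂ζ) := by
    intro k v
    have hi : ∀ n, Integrable (fun x => f x * interp h n v x) ζ := fun n =>
      integrable_mul_continuous hf (hh.continuous_interp n v)
    rw [integral_eq_sum_cells (hi (k + 1)) k, integral_eq_sum_cells (hi k) k,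
      graphEnergy_add_level, ← Finset.sum_sub_distrib, ← Finset.sum_neg_distrib, Finset.mul_sum]
    refine Finset.sum_congr rfl fun w _ => ?_
    simp only [hDc, hh.interp_add_cellMap, hh.interp_cellMap (m := k)]
    set g := harmonicExt h fun i => v (cellMap w (q i)) with hg
    have hgh : IsHarmonic g := hh.isHarmonic_harmonicExt _
    have h1 := hdE k w ((fun x => v (cellMap w x)) - g) fun i => by
      rw [Pi.sub_apply, hg, hh.harmonicExt_q, sub_self]
    have h2 : graphEnergy 1 g (d k w) = 0 := by
      rw [hgh.graphEnergy_eq, graphEnergy_zero]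
      simp [hd0]
    have h3 := hh.graphEnergy_interp 1 0 (fun x => v (cellMap w x)) (d k w)
    rw [add_zero] at h3
    rw [graphEnergy_sub_right, graphEnergy_comm 1 (d k w) g, h2, sub_zero, hh.interp_sub,
      hh.interp_harmonic 1 hgh] at h1
    simp only [Pi.sub_apply, mul_sub] at h1
    rw [integral_sub (integrable_mul_continuous (hfw k w) (hh.continuous_interp 1 _))
      (integrable_mul_continuous (hfw k w) hgh.1)] at h1
    simp only [mul_assoc, integral_const_mul] at h1
    rw [graphEnergy_comm, h3, graphEnergy_comm, h1, ← mul_sub, ← mul_neg, ← mul_assoc, ← mul_pow]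
    norm_num
  refine ⟨fun x => ∑' k, D k x, ?_, fun i => ?_⟩
  · refine hh.hasLaplacian_of_graphEnergy (continuous_tsum hDcont hsum hDb) hf 0 fun n _ v hv => ?_
    rw [graphEnergy_congr (v' := v) (u' := fun x => ∑ k ∈ Finset.range n, D k x)
      (fun w i => tsum_eq_sum fun k hk => hDV n k (by simpa using hk) _ ⟨w, i, rfl⟩)
      fun _ _ => rfl, graphEnergy_sum_left]
    have hk : ∀ k ∈ Finset.range n, graphEnergy n (D k) v =
        -(∫ x, f x * interp h (k + 1) v x ∂ζ - ∫ x, f x * interp h k v x ∂ζ) := by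
      intro k hk
      obtain ⟨j, rfl⟩ := Nat.exists_eq_add_of_le (Finset.mem_range.1 hk)
      have h1 := hh.graphEnergy_interp (k + 1) j v (D k)
      rw [hDi] at h1
      rw [graphEnergy_comm, ← hDE, graphEnergy_comm (k + 1)]
      exact h1
    have h0 : interp h 0 v = 0 := by
      rw [hh.interp_zero]
      funext x
      simp [hv, harmonicExt]
    rw [Finset.sum_congr rfl hk, Finset.sum_neg_distrib,
      Finset.sum_range_sub fun k => ∫ x, f x * interp h k v x ∂ζ, h0]
    simp
  · simp [hDV 0 _ (Nat.zero_le _) _ (q_mem_V_zero i)]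

/-- The Gram matrix of the harmonic functions in `L²(ζ)` is nonsingular. -/
theorem eq_zero_of_integral_sq {ζ : Measure SG} [IsFiniteMeasure ζ] [ζ.IsOpenPosMeasure]
    {a : Fin 3 → ℝ} (ha : ∫ x, harmonicExt h a x * harmonicExt h a x ∂ζ = 0) : a = 0 := by
  have hc : Continuous (harmonicExt h a) := (hh.isHarmonic_harmonicExt a).1
  rw [integral_eq_zero_iff_of_nonneg (fun x => mul_self_nonneg _)
    (integrable_mul_continuous (memLp_of_continuous hc) hc)] at ha
  have h0 := (Continuous.ae_eq_iff_eq ζ (hc.mul hc) continuous_const).1 ha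
  funext i
  rw [← hh.harmonicExt_q a i]
  exact mul_self_eq_zero.1 (congrFun h0 (q i))

/-- On a single cell, the values and normal derivatives at the three vertices can be prescribed
for biharmonic functions. -/
theorem exists_biharmonic_cell (ζ : Measure SG) [IsFiniteMeasure ζ] [NullSingletonClass ζ]
    [ζ.IsOpenPosMeasure] (α β : Fin 3 → ℝ) :
    ∃ (u : SG → ℝ) (c : Fin 3 → ℝ), HasLaplacian ζ u (harmonicExt h c) ∧
      (∀ i, u (q i) = α i) ∧ ∀ i, flux ζ h u (harmonicExt h c) i = β i := by
  have hL2 : ∀ c, MemLp (harmonicExt h c) 2 ζ := fun c =>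
    memLp_of_continuous (hh.isHarmonic_harmonicExt c).1
  have hint : ∀ c i, Integrable (fun x => harmonicExt h c x * h i x) ζ := fun c i =>
    integrable_mul_continuous (hL2 c) (hh.harmonic i).1
  let L : (Fin 3 → ℝ) →ₗ[ℝ] (Fin 3 → ℝ) :=
    { toFun := fun c i => ∫ x, harmonicExt h c x * h i x ∂ζ
      map_add' := fun c c' => by
        funext i
        rw [Pi.add_apply, ← integral_add (hint c i) (hint c' i)]
        simp only [harmonicExt_add, Pi.add_apply, add_mul]
      map_smul' := fun r c => by
        funext i
        simp only [harmonicExt_smul, Pi.smul_apply, smul_eq_mul, mul_assoc, integral_const_mul,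
          RingHom.id_apply] }
  have hinj : Function.Injective L := by
    refine (injective_iff_map_eq_zero L).2 fun c hc => eq_zero_of_integral_sq hh (ζ := ζ) ?_
    rw [integral_mul_harmonicExt hh (hL2 c)]
    exact Finset.sum_eq_zero fun i _ => mul_eq_zero_of_right _ (congrFun hc i)
  obtain ⟨c, hc⟩ := (LinearMap.injective_iff_surjective.1 hinj)
    fun i => β i - vertexFlux (harmonicExt h α) i
  obtain ⟨u, hu, hu0⟩ := exists_hasLaplacian_eq hh (hL2 c)
  have hq : ∀ i, (u + harmonicExt h α) (q i) = α i := fun i => by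
    rw [Pi.add_apply, hu0, hh.harmonicExt_q, zero_add]
  refine ⟨u + harmonicExt h α, c, ?_, hq, fun i => ?_⟩
  · simpa using hu.add hh ((hh.isHarmonic_harmonicExt α).hasLaplacian hh)
  · have h1 := congrFun hc i
    change ∫ x, harmonicExt h c x * h i x ∂ζ = _ at h1
    rw [flux, h1]
    simp only [vertexFlux, hq, hh.harmonicExt_q]
    ring

end

/-! ### Piecewise harmonic functions -/

/-- A function that is, in the interior of each `m`-cell `F_w(SG)`, the harmonic function with
boundary values `γ w`. At a junction point it has the boundary value of one of the cells. -/
def piecewiseHarmonic (h : Fin 3 → SG → ℝ) {m : ℕ} (γ : (Fin m → Fin 3) → Fin 3 → ℝ) : SG → ℝ :=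
  glue cellMap fun w => harmonicExt h (γ w)

theorem exists_piecewiseHarmonic_eq (h : Fin 3 → SG → ℝ) (m : ℕ) (x : SG) :
    ∃ (w : Fin m → Fin 3) (y : SG), ∀ γ, piecewiseHarmonic h γ x = harmonicExt h (γ w) y := by
  have hx : ∃ p : (Fin m → Fin 3) × SG, cellMap p.1 p.2 = x := by
    obtain ⟨w, y, hy⟩ := exists_cellMap_eq m x
    exact ⟨(w, y), hy⟩
  exact ⟨hx.choose.1, hx.choose.2, fun γ => by rw [piecewiseHarmonic, glue, dif_pos hx]⟩

theorem piecewiseHarmonic_cellMap (h : Fin 3 → SG → ℝ) {m : ℕ} (γ : (Fin m → Fin 3) → Fin 3 → ℝ)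
    (w : Fin m → Fin 3) {x : SG} (hx : x ∉ V 0) :
    piecewiseHarmonic h γ (cellMap w x) = harmonicExt h (γ w) x :=
  glue_cellMap_of_notMem _ w hx

theorem piecewiseHarmonic_add (h : Fin 3 → SG → ℝ) {m : ℕ} (γ γ' : (Fin m → Fin 3) → Fin 3 → ℝ) :
    piecewiseHarmonic h (γ + γ') = piecewiseHarmonic h γ + piecewiseHarmonic h γ' := by
  funext x
  obtain ⟨w, y, hx⟩ := exists_piecewiseHarmonic_eq h m x
  simp only [Pi.add_apply, hx, harmonicExt_add]

theorem piecewiseHarmonic_smul (h : Fin 3 → SG → ℝ) {m : ℕ} (c : ℝ)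
    (γ : (Fin m → Fin 3) → Fin 3 → ℝ) :
    piecewiseHarmonic h (c • γ) = c • piecewiseHarmonic h γ := by
  funext x
  obtain ⟨w, y, hx⟩ := exists_piecewiseHarmonic_eq h m x
  simp only [Pi.smul_apply, hx, harmonicExt_smul]

theorem ae_notMem_V (ζ : Measure SG) [NullSingletonClass ζ] (m : ℕ) : ∀ᵐ x ∂ζ, x ∉ V m := by
  rw [ae_iff]
  simp only [not_not]
  exact (V_finite m).measure_zero ζ

theorem piecewiseHarmonic_ae_eq (ζ : Measure SG) [NullSingletonClass ζ] (h : Fin 3 → SG → ℝ) {m : ℕ}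
    (γ : (Fin m → Fin 3) → Fin 3 → ℝ) (w : Fin m → Fin 3) :
    (fun x => piecewiseHarmonic h γ (cellMap w x)) =ᵐ[cellMeasure ζ w] harmonicExt h (γ w) := by
  filter_upwards [ae_notMem_V (cellMeasure ζ w) 0] with x hx
  exact piecewiseHarmonic_cellMap h γ w hx

section
variable {h : Fin 3 → SG → ℝ} (hh : IsHarmonicBasis h) {ζ : Measure SG} [IsFiniteMeasure ζ]
  [NullSingletonClass ζ]
include hh

theorem memLp_piecewiseHarmonic {m : ℕ} (γ : (Fin m → Fin 3) → Fin 3 → ℝ) :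
    MemLp (piecewiseHarmonic h γ) 2 ζ := by
  obtain ⟨C, hC0, hC⟩ := hh.exists_bound
  refine MemLp.of_bound ?_ (C * ∑ w, ∑ i, |γ w i|) (ae_of_all _ fun x => ?_)
  · rw [← sum_map_cellMeasure ζ m, ← Measure.sum_fintype]
    refine AEStronglyMeasurable.sum_measure fun w => ?_
    rw [(measurableEmbedding_cellMap w).aestronglyMeasurable_map_iff]
    exact ((hh.isHarmonic_harmonicExt (γ w)).1.aestronglyMeasurable).congr
      (piecewiseHarmonic_ae_eq ζ h γ w).symm
  · obtain ⟨w, y, hx⟩ := exists_piecewiseHarmonic_eq h m x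
    rw [hx]
    refine hC _ _ (fun i => ?_) y
    refine (Finset.single_le_sum (f := fun i => |γ w i|) (fun i _ => abs_nonneg _)
      (Finset.mem_univ i)).trans ?_
    exact Finset.single_le_sum (f := fun w => ∑ i, |γ w i|)
      (fun w _ => Finset.sum_nonneg fun i _ => abs_nonneg _) (Finset.mem_univ w)

theorem integral_mul_piecewiseHarmonic {f : SG → ℝ} (hf : MemLp f 2 ζ) {m : ℕ}
    (γ : (Fin m → Fin 3) → Fin 3 → ℝ) :
    ∫ x, f x * piecewiseHarmonic h γ x ∂ζ =
      ∑ w, ∫ x, f (cellMap w x) * harmonicExt h (γ w) x ∂cellMeasure ζ w := by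
  rw [integral_eq_sum_cells (f := fun x => f x * piecewiseHarmonic h γ x)
    (hf.integrable_mul (memLp_piecewiseHarmonic hh γ)) m]
  refine Finset.sum_congr rfl fun w _ => integral_congr_ae ?_
  filter_upwards [piecewiseHarmonic_ae_eq ζ h γ w] with x hx
  rw [hx]

/-- **Green's second identity** on the `m`-cells, for a function in the domain of the Laplacian and
a piecewise harmonic function. -/
theorem integral_laplacian_mul_piecewiseHarmonic {u f : SG → ℝ} (hu : HasLaplacian ζ u f) {m : ℕ}
    (γ : (Fin m → Fin 3) → Fin 3 → ℝ) :
    ∫ x, f x * piecewiseHarmonic h γ x ∂ζ =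
      ∑ w, ∑ i, γ w i * cellFlux ζ h u f w i -
        (5 / 3) ^ m * ∑ w, ∑ i, vertexFlux (harmonicExt h (γ w)) i * u (cellMap w (q i)) := by
  rw [integral_mul_piecewiseHarmonic hh hu.2.1, Finset.mul_sum, ← Finset.sum_sub_distrib]
  refine Finset.sum_congr rfl fun w _ => ?_
  rw [integral_mul_harmonicExt hh (MemLp.comp_cellMap hu.2.1 w),
    ← graphEnergy_zero _ fun x => u (cellMap w x), graphEnergy_comm, graphEnergy_zero,
    Finset.mul_sum, ← Finset.sum_sub_distrib]
  refine Finset.sum_congr rfl fun i _ => ?_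
  rw [cellFlux, hh.harmonicExt_q]
  ring

end

/-! ### Matching conditions at junction points -/

theorem address_index_eq {m : ℕ} {w : Fin m → Fin 3} {i j : Fin 3}
    (he : cellMap w (q i) = cellMap w (q j)) : i = j := q_injective (cellMap_injective w he)

/-- A vertex of two different cells is not in `V_0`. -/
theorem notMem_V_zero_of_ne {m : ℕ} {w w' : Fin m → Fin 3} {i j : Fin 3} (hw : w ≠ w')
    (he : cellMap w (q i) = cellMap w' (q j)) : cellMap w (q i) ∉ V 0 := by
  intro h0
  obtain ⟨k, hk⟩ := mem_V_zero.1 h0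
  exact hw ((cellMap_eq_q_iff.1 hk.symm).1.trans (cellMap_eq_q_iff.1 (hk.trans he).symm).1.symm)

/-- A sum over all vertices of all `m`-cells vanishes if its terms vanish at `V_0` and cancel in
pairs at the other junction points, which are vertices of exactly two cells. -/
theorem sum_eq_zero_of_matching {m : ℕ} {f : (Fin m → Fin 3) → Fin 3 → ℝ}
    (h0 : ∀ w i, cellMap w (q i) ∈ V 0 → f w i = 0)
    (h1 : ∀ w w' i j, w ≠ w' → cellMap w (q i) = cellMap w' (q j) → f w i + f w' j = 0) :
    ∑ w, ∑ i, f w i = 0 := by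
  classical
  have hex : ∀ p : (Fin m → Fin 3) × Fin 3, ∃ p' : (Fin m → Fin 3) × Fin 3,
      (cellMap p.1 (q p.2) ∈ V 0 ∧ p' = p) ∨
        (p'.1 ≠ p.1 ∧ cellMap p'.1 (q p'.2) = cellMap p.1 (q p.2)) := by
    rintro ⟨w, i⟩
    by_cases hV : cellMap w (q i) ∈ V 0
    · exact ⟨(w, i), Or.inl ⟨hV, rfl⟩⟩
    · obtain ⟨w', i', h⟩ := exists_other_address w i hV
      exact ⟨(w', i'), Or.inr h⟩
  choose σ hσ using hex
  rw [← Fintype.sum_prod_type' f]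
  refine Finset.sum_involution (fun p _ => σ p) ?_ ?_ (fun _ _ => Finset.mem_univ _) ?_
  · rintro ⟨w, i⟩ -
    rcases hσ (w, i) with ⟨hV, he⟩ | ⟨hne, he⟩
    · rw [he, h0 w i hV, add_zero]
    · exact h1 _ _ _ _ hne.symm he.symm
  · rintro ⟨w, i⟩ - hf he
    rcases hσ (w, i) with ⟨hV, -⟩ | ⟨hne, -⟩
    · exact hf (h0 w i hV)
    · exact hne (by rw [he])
  · intro p _
    rcases hσ p with ⟨hV, he⟩ | ⟨hne, he⟩
    · rw [he, he]
    · rcases hσ (σ p) with ⟨hV, -⟩ | ⟨hne', he'⟩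
      · exact absurd hV (notMem_V_zero_of_ne hne he)
      · have hw : (σ (σ p)).1 = p.1 :=
          (address_eq_or_eq hne.symm he.symm (he'.trans he)).resolve_right hne'
        refine Prod.ext hw (address_index_eq (w := p.1) ?_)
        rw [← he, ← he', hw]

/-- At a junction point with the two addresses `(w, i)` and `(w', j)` every sum over addresses has
two terms. -/
theorem sum_indicator_vertex {m : ℕ} [DecidableEq SG] {w w' : Fin m → Fin 3} {i j : Fin 3}
    (hw : w ≠ w') (he : cellMap w (q i) = cellMap w' (q j)) (f : (Fin m → Fin 3) → Fin 3 → ℝ) :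
    ∑ w₁, ∑ i₁, f w₁ i₁ * (if cellMap w₁ (q i₁) = cellMap w (q i) then 1 else 0) =
      f w i + f w' j := by
  rw [← Fintype.sum_prod_type' fun w₁ i₁ =>
    f w₁ i₁ * (if cellMap w₁ (q i₁) = cellMap w (q i) then 1 else 0)]
  rw [Fintype.sum_eq_add (w, i) (w', j) fun h => hw (congrArg Prod.fst h)]
  · simp [he]
  · rintro ⟨w₁, i₁⟩ ⟨hne, hne'⟩
    refine mul_eq_zero_of_right _ (if_neg fun (h1 : cellMap w₁ (q i₁) = cellMap w (q i)) => ?_)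
    rcases address_eq_or_eq hw he h1 with rfl | rfl
    · exact hne (congrArg (Prod.mk w₁) (address_index_eq h1))
    · exact hne' (congrArg (Prod.mk w₁) (address_index_eq (h1.trans he)))

/-- At a point of `V_0` every sum over addresses has one term. -/
theorem sum_indicator_vertex_of_mem {m : ℕ} [DecidableEq SG] {w : Fin m → Fin 3} {i : Fin 3}
    (hV : cellMap w (q i) ∈ V 0) (f : (Fin m → Fin 3) → Fin 3 → ℝ) :
    ∑ w₁, ∑ i₁, f w₁ i₁ * (if cellMap w₁ (q i₁) = cellMap w (q i) then 1 else 0) = f w i := by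
  rw [← Fintype.sum_prod_type' fun w₁ i₁ =>
    f w₁ i₁ * (if cellMap w₁ (q i₁) = cellMap w (q i) then 1 else 0)]
  rw [Fintype.sum_eq_single (w, i)]
  · simp
  · rintro ⟨w₁, i₁⟩ hne
    refine mul_eq_zero_of_right _ (if_neg fun (h1 : cellMap w₁ (q i₁) = cellMap w (q i)) => ?_)
    by_cases hw : w₁ = w
    · subst hw
      exact hne (congrArg (Prod.mk w₁) (address_index_eq h1))
    · exact notMem_V_zero_of_ne (Ne.symm hw) h1.symm hV

section
variable {h : Fin 3 → SG → ℝ} (hh : IsHarmonicBasis h) {ζ : Measure SG} [IsFiniteMeasure ζ]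
  [NullSingletonClass ζ]
include hh

theorem cellFlux_add_cellFlux {u f : SG → ℝ} (hu : HasLaplacian ζ u f) {m : ℕ}
    {w w' : Fin m → Fin 3} {i j : Fin 3} (hw : w ≠ w')
    (he : cellMap w (q i) = cellMap w' (q j)) :
    cellFlux ζ h u f w i + cellFlux ζ h u f w' j = 0 := by
  classical
  rw [← sum_indicator_vertex hw he fun w i => cellFlux ζ h u f w i]
  refine sum_cellFlux_eq_zero hh hu m (v := fun x => if x = cellMap w (q i) then 1 else 0)
    fun k => if_neg fun (hk : q k = cellMap w (q i)) =>
      notMem_V_zero_of_ne hw he (hk ▸ q_mem_V_zero k)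

/-- Existence of biharmonic splines: piecewise biharmonic functions with prescribed values at the
junction points and prescribed normal derivatives, subject only to the matching condition. -/
theorem exists_biharmonic_spline [ζ.IsOpenPosMeasure] {m : ℕ} (A : SG → ℝ)
    {D : (Fin m → Fin 3) → Fin 3 → ℝ}
    (hD : ∀ w w' i j, w ≠ w' → cellMap w (q i) = cellMap w' (q j) → D w i + D w' j = 0) :
    ∃ (u : SG → ℝ) (γ : (Fin m → Fin 3) → Fin 3 → ℝ), HasLaplacian ζ u (piecewiseHarmonic h γ) ∧
      (∀ (w : Fin m → Fin 3) i, u (cellMap w (q i)) = A (cellMap w (q i))) ∧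
      ∀ w i, cellFlux ζ h u (piecewiseHarmonic h γ) w i = D w i := by
  choose U c hU hq hflux using fun w : Fin m → Fin 3 =>
    exists_biharmonic_cell hh (cellMeasure ζ w) (fun i => A (cellMap w (q i)))
      fun i => (3 / 5) ^ m * D w i
  have hu : ∀ (w : Fin m → Fin 3) x, glue cellMap U (cellMap w x) = U w x :=
    glue_cellMap fun w w' i j he => by rw [hq, hq, he]
  have hs : (3 / 5 : ℝ) ^ m * (5 / 3) ^ m = 1 := by
    rw [← mul_pow]
    norm_num
  have hs' : (5 / 3 : ℝ) ^ m * (3 / 5) ^ m = 1 := by rw [mul_comm, hs]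
  set γ : (Fin m → Fin 3) → Fin 3 → ℝ := fun w => (5 / 3 : ℝ) ^ m • c w with hγ
  have hae : ∀ w, harmonicExt h (c w) =ᵐ[cellMeasure ζ w]
      fun x => (3 / 5) ^ m * piecewiseHarmonic h γ (cellMap w x) := by
    intro w
    filter_upwards [piecewiseHarmonic_ae_eq ζ h γ w] with x hx
    rw [hx, hγ]
    simp only [harmonicExt_smul, Pi.smul_apply, smul_eq_mul]
    rw [← mul_assoc, hs, one_mul]
  have hcf : ∀ w i, cellFlux ζ h (glue cellMap U) (piecewiseHarmonic h γ) w i = D w i := by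
    intro w i
    rw [cellFlux_eq]
    simp only [hu]
    have : flux (cellMeasure ζ w) h (fun x => U w x)
        (fun x => (3 / 5) ^ m * piecewiseHarmonic h γ (cellMap w x)) i = (3 / 5) ^ m * D w i := by
      rw [← hflux w i, flux, flux]
      congr 1
      refine integral_congr_ae ?_
      filter_upwards [hae w] with x hx
      rw [hx]
    rw [this, ← mul_assoc, hs', one_mul]
  refine ⟨glue cellMap U, γ, ?_, fun w i => by rw [hu, hq], hcf⟩
  refine hasLaplacian_of_cells hh (memLp_piecewiseHarmonic hh γ) (m := m) (fun w => ?_)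
    fun v hv => ?_
  · simp only [hu]
    exact (hU w).congr_ae (hae w)
  · refine sum_eq_zero_of_matching (fun w i hV => ?_) fun w w' i j hw he => ?_
    · obtain ⟨k, hk⟩ := mem_V_zero.1 hV
      rw [← hk, hv, mul_zero]
    · rw [hcf, hcf, ← he, ← add_mul, hD w w' i j hw he, zero_mul]

end

/-! ### Biharmonicity away from a set of junction points -/

theorem HasNormalDeriv.sub {u v : SG → ℝ} {m : ℕ} {w : Fin m → Fin 3} {i : Fin 3} {d e : ℝ}
    (hu : HasNormalDeriv u w i d) (hv : HasNormalDeriv v w i e) :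
    HasNormalDeriv (u - v) w i (d - e) := by
  refine (Tendsto.sub hu hv).congr fun k => ?_
  simp only [Pi.sub_apply]
  ring

theorem HasNormalDeriv.smul {u : SG → ℝ} {m : ℕ} {w : Fin m → Fin 3} {i : Fin 3} {d : ℝ}
    (hu : HasNormalDeriv u w i d) (c : ℝ) : HasNormalDeriv (c • u) w i (c * d) := by
  refine (Tendsto.const_mul c hu).congr fun k => ?_
  simp only [Pi.smul_apply, smul_eq_mul]
  ring

theorem HasNormalDeriv.add {u v : SG → ℝ} {m : ℕ} {w : Fin m → Fin 3} {i : Fin 3} {d e : ℝ}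
    (hu : HasNormalDeriv u w i d) (hv : HasNormalDeriv v w i e) :
    HasNormalDeriv (u + v) w i (d + e) := by
  have := hu.sub (hv.smul (-1))
  simpa using this

theorem continuousAt_of_cells {m : ℕ} {g : SG → ℝ} {y : SG}
    (H : ∀ (w : Fin m → Fin 3) x, cellMap w x = y → Tendsto (fun z => g (cellMap w z)) (𝓝 x)
      (𝓝 (g y))) : ContinuousAt g y := by
  have hu : (⋃ w : Fin m → Fin 3, Set.range (cellMap w)) = Set.univ :=
    Set.iUnion_eq_univ_iff.2 fun x => by
      obtain ⟨w, z, hz⟩ := exists_cellMap_eq m x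
      exact ⟨w, z, hz⟩
  rw [ContinuousAt, ← nhdsWithin_univ, ← hu, nhdsWithin_iUnion, tendsto_iSup]
  intro w
  by_cases hy : y ∈ Set.range (cellMap w)
  · obtain ⟨x, rfl⟩ := hy
    rw [← (isClosedEmbedding_cellMap w).isInducing.map_nhds_eq, tendsto_map'_iff]
    exact H w x rfl
  · have hb : 𝓝[Set.range (cellMap w)] y = ⊥ := by
      rwa [← notMem_closure_iff_nhdsWithin_eq_bot,
        (isClosedEmbedding_cellMap w).isClosed_range.closure_eq]
    rw [hb]
    exact tendsto_bot

section
variable {h : Fin 3 → SG → ℝ} (hh : IsHarmonicBasis h)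
include hh

/-- The normal derivative of a function that is harmonic in a cell, at a vertex where it has the
boundary value of the cell. -/
theorem hasNormalDeriv_of_harmonicExt {m : ℕ} {g : SG → ℝ} {w : Fin m → Fin 3} {i : Fin 3}
    {a : Fin 3 → ℝ} (hg : ∀ x, x ∉ V 0 → g (cellMap w x) = harmonicExt h a x)
    (hi : g (cellMap w (q i)) = a i) :
    HasNormalDeriv g w i ((5 / 3) ^ m * vertexFlux (harmonicExt h a) i) := by
  have : NullSingletonClass (0 : Measure SG) := ⟨fun _ => rfl⟩
  have h1 := tendsto_flux hh
    ((hh.isHarmonic_harmonicExt a).hasLaplacian hh (ζ := (0 : Measure SG))) i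
  have h2 : flux 0 h (harmonicExt h a) 0 i = vertexFlux (harmonicExt h a) i := by simp [flux]
  rw [h2] at h1
  refine (h1.const_mul ((5 / 3) ^ m)).congr' ?_
  filter_upwards [eventually_ne_atTop 0] with k hk
  rw [hg _ (iterate_F_q_notMem (fin_three_add_one_ne i) hk),
    hg _ (iterate_F_q_notMem (fin_three_sub_one_ne i) hk), hi, hh.harmonicExt_q]

end

/-- The matching conditions off `E` for the piecewise harmonic function with boundary values `γ w`
on the cells: at the junction points outside `E` the values agree and the normal derivatives (up to
the common factor `(5/3)^m`) cancel, at those in `V_0` both vanish. -/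
structure MatchesOff (h : Fin 3 → SG → ℝ) {m : ℕ} (E : Set SG)
    (γ : (Fin m → Fin 3) → Fin 3 → ℝ) : Prop where
  value_eq_zero : ∀ w i, cellMap w (q i) ∉ E → cellMap w (q i) ∈ V 0 → γ w i = 0
  flux_eq_zero : ∀ w i, cellMap w (q i) ∉ E → cellMap w (q i) ∈ V 0 →
    vertexFlux (harmonicExt h (γ w)) i = 0
  value_eq : ∀ w w' i j, cellMap w (q i) ∉ E → w ≠ w' → cellMap w (q i) = cellMap w' (q j) →
    γ w i = γ w' j
  flux_add : ∀ w w' i j, cellMap w (q i) ∉ E → w ≠ w' → cellMap w (q i) = cellMap w' (q j) →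
    vertexFlux (harmonicExt h (γ w)) i + vertexFlux (harmonicExt h (γ w')) j = 0

section
variable {h : Fin 3 → SG → ℝ} (hh : IsHarmonicBasis h) {ζ : Measure SG}
include hh

/-- The piecewise harmonic function with matching boundary values serves as the representative of
the Laplacian: at a junction point outside `E` all choices of its value agree. -/
theorem MatchesOff.isBiharmonicAwayFrom {m : ℕ} {E : Set SG} {γ : (Fin m → Fin 3) → Fin 3 → ℝ}
    (hγ : MatchesOff h E γ) {u : SG → ℝ} (hu : HasLaplacian ζ u (piecewiseHarmonic h γ)) :
    IsBiharmonicAwayFrom ζ m E u := by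
  have hval : ∀ w i, cellMap w (q i) ∉ E → piecewiseHarmonic h γ (cellMap w (q i)) = γ w i := by
    intro w i hE
    rw [piecewiseHarmonic, glue_apply, hh.harmonicExt_q]
    intro w' x' he
    by_cases hw : w = w'
    · subst hw
      rw [cellMap_injective w he]
    · obtain ⟨j, rfl⟩ := mem_V_zero.1 (mem_V_zero_of_cellMap_eq hw he.symm).2
      rw [hh.harmonicExt_q, hh.harmonicExt_q]
      exact (hγ.value_eq w w' i j hE hw he.symm).symm
  have hflux : ∀ w i, cellMap w (q i) ∉ E → HasNormalDeriv (piecewiseHarmonic h γ) w i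
      ((5 / 3) ^ m * vertexFlux (harmonicExt h (γ w)) i) := fun w i hE =>
    hasNormalDeriv_of_harmonicExt hh (fun x hx => piecewiseHarmonic_cellMap h γ w hx) (hval w i hE)
  refine ⟨piecewiseHarmonic h γ, ⟨hu, fun w => ⟨_, hh.isHarmonic_harmonicExt (γ w), fun x hx =>
    piecewiseHarmonic_cellMap h γ w hx⟩⟩, ?_, ?_⟩
  · rintro y ⟨⟨w₀, i₀, rfl⟩, hE⟩
    refine ⟨continuousAt_of_cells (m := m) fun w x hx => ?_, ?_⟩
    · have hxV : x ∈ V 0 := by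
        by_contra hxV
        obtain ⟨-, rfl⟩ := cellMap_eq_of_notMem hxV hx
        exact hxV (q_mem_V_zero _)
      obtain ⟨i, rfl⟩ := mem_V_zero.1 hxV
      rw [← hx] at hE ⊢
      have hlim := (hh.isHarmonic_harmonicExt (γ w)).1.tendsto (q i)
      rw [hval w i hE, ← hh.harmonicExt_q (γ w) i]
      refine hlim.congr' ?_
      have hfin : (V 0 \ {q i}).Finite := (V_finite 0).subset Set.sdiff_subset
      filter_upwards [hfin.isClosed.isOpen_compl.mem_nhds (show q i ∈ (V 0 \ {q i})ᶜ by simp)]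
        with z hz
      by_cases hzV : z ∈ V 0
      · have hzi : z = q i := by
          by_contra hne
          exact hz ⟨hzV, hne⟩
        rw [hzi, hval w i hE, hh.harmonicExt_q]
      · exact (piecewiseHarmonic_cellMap h γ w hzV).symm
    · intro w w' i j hw hy hy'
      rw [← hy] at hE
      refine ⟨_, hflux w i hE, ?_⟩
      have h1 := hγ.flux_add w w' i j hE hw (hy.trans hy'.symm)
      rw [← mul_neg, eq_neg_of_add_eq_zero_left h1, neg_neg]
      refine hflux w' j ?_
      rwa [hy', ← hy]
  · rintro y ⟨hV, hE⟩
    constructor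
    · obtain ⟨k, rfl⟩ := mem_V_zero.1 hV
      have hk : cellMap (fun _ : Fin m => k) (q k) = q k := cellMap_eq_q_iff.2 ⟨rfl, rfl⟩
      rw [← hk] at hV hE ⊢
      rw [hval _ _ hE, hγ.value_eq_zero _ _ hE hV]
    · rintro w i rfl
      have := hflux w i hE
      rwa [hγ.flux_eq_zero w i hE hV, mul_zero] at this

/-- The Laplacian of a function biharmonic away from `E` is given by matching boundary values on
the cells. -/
theorem exists_matchesOff [NullSingletonClass ζ] {m : ℕ} {E : Set SG} {u : SG → ℝ}
    (hu : IsBiharmonicAwayFrom ζ m E u) :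
    ∃ γ : (Fin m → Fin 3) → Fin 3 → ℝ, MatchesOff h E γ ∧
      HasLaplacian ζ u (piecewiseHarmonic h γ) := by
  obtain ⟨g, ⟨hg, hharm⟩, hV, hV0⟩ := hu
  choose H hH hgH using hharm
  set γ : (Fin m → Fin 3) → Fin 3 → ℝ := fun w i => H w (q i) with hγ
  have hHγ : ∀ w, H w = harmonicExt h (γ w) := fun w => hh.eq_harmonicExt (hH w)
  have hgγ : ∀ w x, x ∉ V 0 → g (cellMap w x) = harmonicExt h (γ w) x := fun w x hx => by
    rw [hgH w x hx, hHγ]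
  have hmem : ∀ (w : Fin m → Fin 3) i, cellMap w (q i) ∈ V m := fun w i => ⟨w, i, rfl⟩
  -- Continuity of `g` at a vertex forces it to take the boundary value of each cell there.
  have hval : ∀ w i, cellMap w (q i) ∉ E → g (cellMap w (q i)) = γ w i := by
    intro w i hE
    have h1 : Tendsto (fun k => (F i)^[k] (q (i + 1))) atTop (𝓝 (q i)) := tendsto_iterate_F i _
    have h2 := (hV _ ⟨hmem w i, hE⟩).1.tendsto.comp
      (((continuous_cellMap w).tendsto (q i)).comp h1)
    have h3 := ((hH w).1.tendsto (q i)).comp h1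
    refine tendsto_nhds_unique h2 (h3.congr' ?_)
    filter_upwards [eventually_ne_atTop 0] with k hk
    exact (hgH w _ (iterate_F_q_notMem (fin_three_add_one_ne i) hk)).symm
  have hflux : ∀ w i d, cellMap w (q i) ∉ E → HasNormalDeriv g w i d →
      d = (5 / 3) ^ m * vertexFlux (harmonicExt h (γ w)) i := fun w i d hE hd =>
    tendsto_nhds_unique hd (hasNormalDeriv_of_harmonicExt hh (hgγ w) (hval w i hE))
  have hpos : (5 / 3 : ℝ) ^ m ≠ 0 := by positivity
  refine ⟨γ, ⟨fun w i hE h0 => ?_, fun w i hE h0 => ?_, fun w w' i j hE hw he => ?_,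
    fun w w' i j hE hw he => ?_⟩, hg.congr_ae ?_⟩
  · rw [← hval w i hE, (hV0 _ ⟨h0, hE⟩).1]
  · have := hflux w i 0 hE ((hV0 _ ⟨h0, hE⟩).2 w i rfl)
    exact (mul_eq_zero.1 this.symm).resolve_left hpos
  · rw [← hval w i hE, he, hval w' j (he ▸ hE)]
  · obtain ⟨d, hd, hd'⟩ := (hV _ ⟨hmem w i, hE⟩).2 w w' i j hw rfl he.symm
    have e1 := hflux w i d hE hd
    have e2 := hflux w' j (-d) (he ▸ hE) hd'
    refine (mul_eq_zero.1 ?_).resolve_left hpos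
    rw [mul_add, ← e1, ← e2, add_neg_cancel]
  · filter_upwards [ae_notMem_V ζ m] with x hx
    obtain ⟨w, y, rfl⟩ := exists_cellMap_eq m x
    have hy : y ∉ V 0 := fun hy => by
      obtain ⟨i, rfl⟩ := mem_V_zero.1 hy
      exact hx (hmem w i)
    rw [hgγ w y hy, piecewiseHarmonic_cellMap h γ w hy]

end

/-! ### Orthogonality and the variational problem -/

section
variable {h : Fin 3 → SG → ℝ} (hh : IsHarmonicBasis h) {ζ : Measure SG} [IsFiniteMeasure ζ]
  [NullSingletonClass ζ]
include hh

/-- A piecewise harmonic function satisfying the matching conditions off `E` is orthogonal to the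
Laplacians of all functions whose values and normal derivatives vanish on `E`. -/
theorem MatchesOff.integral_eq_zero {m : ℕ} {E : Set SG} {γ : (Fin m → Fin 3) → Fin 3 → ℝ}
    (hγ : MatchesOff h E γ) {s f : SG → ℝ} (hs : HasLaplacian ζ s f)
    (h0 : ∀ (w : Fin m → Fin 3) i, cellMap w (q i) ∈ E → s (cellMap w (q i)) = 0)
    (h1 : ∀ (w : Fin m → Fin 3) i, cellMap w (q i) ∈ E → cellFlux ζ h s f w i = 0) :
    ∫ x, f x * piecewiseHarmonic h γ x ∂ζ = 0 := by
  rw [integral_laplacian_mul_piecewiseHarmonic hh hs, sum_eq_zero_of_matching,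
    sum_eq_zero_of_matching, mul_zero, sub_zero]
  · intro w i hV
    by_cases hE : cellMap w (q i) ∈ E
    · rw [h0 w i hE, mul_zero]
    · rw [hγ.flux_eq_zero w i hE hV, zero_mul]
  · intro w w' i j hw he
    rw [← he, ← add_mul]
    by_cases hE : cellMap w (q i) ∈ E
    · rw [h0 w i hE, mul_zero]
    · rw [hγ.flux_add w w' i j hE hw he, zero_mul]
  · intro w i hV
    by_cases hE : cellMap w (q i) ∈ E
    · rw [h1 w i hE, mul_zero]
    · rw [hγ.value_eq_zero w i hE hV, zero_mul]
  · intro w w' i j hw he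
    by_cases hE : cellMap w (q i) ∈ E
    · rw [h1 w i hE, h1 w' j (he ▸ hE), mul_zero, mul_zero, add_zero]
    · rw [hγ.value_eq w w' i j hE hw he, ← mul_add, cellFlux_add_cellFlux hh hs hw he, mul_zero]

/-- Conversely, orthogonality to the Laplacians of the splines with vanishing data on `E` gives the
matching conditions off `E`. -/
theorem matchesOff_of_orthogonal [ζ.IsOpenPosMeasure] {m : ℕ} {E : Set SG}
    {γ : (Fin m → Fin 3) → Fin 3 → ℝ}
    (horth : ∀ (s : SG → ℝ) (κ : (Fin m → Fin 3) → Fin 3 → ℝ),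
      HasLaplacian ζ s (piecewiseHarmonic h κ) →
      (∀ (w : Fin m → Fin 3) i, cellMap w (q i) ∈ E →
        s (cellMap w (q i)) = 0 ∧ HasNormalDeriv s w i 0) →
      ∫ x, piecewiseHarmonic h κ x * piecewiseHarmonic h γ x ∂ζ = 0) :
    MatchesOff h E γ := by
  classical
  have hpos : (5 / 3 : ℝ) ^ m ≠ 0 := by positivity
  have key : ∀ (A : SG → ℝ) (D : (Fin m → Fin 3) → Fin 3 → ℝ),
      (∀ w w' i j, w ≠ w' → cellMap w (q i) = cellMap w' (q j) → D w i + D w' j = 0) →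
      (∀ (w : Fin m → Fin 3) i, cellMap w (q i) ∈ E → A (cellMap w (q i)) = 0 ∧ D w i = 0) →
      ∑ w, ∑ i, γ w i * D w i -
        (5 / 3) ^ m * ∑ w, ∑ i, vertexFlux (harmonicExt h (γ w)) i * A (cellMap w (q i)) = 0 := by
    intro A D hD hE
    obtain ⟨s, κ, hs, hsA, hsD⟩ := exists_biharmonic_spline hh (ζ := ζ) A hD
    have h1 := horth s κ hs fun w i hw => by
      have h2 := hasNormalDeriv_cellFlux hh hs w i
      rw [hsD, (hE w i hw).2] at h2
      exact ⟨(hsA w i).trans (hE w i hw).1, h2⟩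
    rw [integral_laplacian_mul_piecewiseHarmonic hh hs] at h1
    simpa only [hsA, hsD] using h1
  -- Splines with normal derivatives zero and values given by the indicator function of a point.
  have keyA : ∀ (w : Fin m → Fin 3) i, cellMap w (q i) ∉ E →
      ∑ w₁, ∑ i₁, vertexFlux (harmonicExt h (γ w₁)) i₁ *
        (if cellMap w₁ (q i₁) = cellMap w (q i) then 1 else 0) = 0 := by
    intro w i hE
    have h1 := key (fun x => if x = cellMap w (q i) then 1 else 0) 0 (fun _ _ _ _ _ _ => by simp)
      fun w₁ i₁ hE₁ => ⟨if_neg fun (he : cellMap w₁ (q i₁) = cellMap w (q i)) => hE (he ▸ hE₁), rfl⟩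
    simp only [Pi.zero_apply, mul_zero, Finset.sum_const_zero, zero_sub, neg_eq_zero] at h1
    exact (mul_eq_zero.1 h1).resolve_left hpos
  -- Splines with values zero.
  have keyD : ∀ D : (Fin m → Fin 3) → Fin 3 → ℝ,
      (∀ w w' i j, w ≠ w' → cellMap w (q i) = cellMap w' (q j) → D w i + D w' j = 0) →
      (∀ w i, cellMap w (q i) ∈ E → D w i = 0) → ∑ w, ∑ i, γ w i * D w i = 0 := by
    intro D hD hE
    have h1 := key (fun _ => 0) D hD fun w i hw => ⟨rfl, hE w i hw⟩
    simpa using h1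
  refine ⟨fun w i hE hV => ?_, fun w i hE hV => ?_, fun w w' i j hE hw he => ?_,
    fun w w' i j hE hw he => ?_⟩
  · rw [← sum_indicator_vertex_of_mem hV γ]
    refine keyD (fun w₁ i₁ => if cellMap w₁ (q i₁) = cellMap w (q i) then 1 else 0)
      (fun w₁ w₂ i₁ i₂ h₁₂ he => ?_) fun w₁ i₁ hE₁ =>
        if_neg fun (he : cellMap w₁ (q i₁) = cellMap w (q i)) => hE (he ▸ hE₁)
    have hn : cellMap w₁ (q i₁) ≠ cellMap w (q i) := fun h1 =>
      notMem_V_zero_of_ne h₁₂ he (h1 ▸ hV)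
    rw [if_neg hn, if_neg (he ▸ hn), add_zero]
  · rw [← sum_indicator_vertex_of_mem hV fun w i => vertexFlux (harmonicExt h (γ w)) i]
    exact keyA w i hE
  · -- The normal derivative is `1` with respect to one cell and `-1` with respect to the other.
    have h1 := keyD (fun w₁ i₁ => (if w₁ = w then 1 else -1) *
        (if cellMap w₁ (q i₁) = cellMap w (q i) then 1 else 0)) (fun w₁ w₂ i₁ i₂ h₁₂ he' => ?_)
      fun w₁ i₁ hE₁ => mul_eq_zero_of_right _
        (if_neg fun (he : cellMap w₁ (q i₁) = cellMap w (q i)) => hE (he ▸ hE₁))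
    · simp only [← mul_assoc] at h1
      rw [sum_indicator_vertex hw he fun w₁ i₁ => γ w₁ i₁ * (if w₁ = w then 1 else -1),
        if_pos rfl, if_neg hw.symm] at h1
      linarith
    · rw [← he', ← add_mul]
      by_cases hy : cellMap w₁ (q i₁) = cellMap w (q i)
      · refine mul_eq_zero_of_left ?_ _
        by_cases hw₁ : w₁ = w
        · rw [if_pos hw₁, if_neg fun h => h₁₂ (hw₁.trans h.symm), add_neg_cancel]
        · have hw₂ : w₂ = w :=
            ((address_eq_or_eq h₁₂ he' hy.symm).resolve_left (Ne.symm hw₁)).symm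
          rw [if_neg hw₁, if_pos hw₂, neg_add_cancel]
      · rw [if_neg hy, mul_zero]
  · rw [← sum_indicator_vertex hw he fun w i => vertexFlux (harmonicExt h (γ w)) i]
    exact keyA w i hE

/-- Subtracting from a given piecewise harmonic function its orthogonal projection onto the
(finite-dimensional) space of Laplacians of splines with vanishing data on `E` gives a function that
matches off `E`. -/
theorem exists_matchesOff_sub [ζ.IsOpenPosMeasure] {m : ℕ} (E : Set SG)
    (γ₀ : (Fin m → Fin 3) → Fin 3 → ℝ) :
    ∃ (s : SG → ℝ) (κ : (Fin m → Fin 3) → Fin 3 → ℝ), HasLaplacian ζ s (piecewiseHarmonic h κ) ∧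
      (∀ (w : Fin m → Fin 3) i, cellMap w (q i) ∈ E →
        s (cellMap w (q i)) = 0 ∧ HasNormalDeriv s w i 0) ∧ MatchesOff h E (γ₀ - κ) := by
  have hL2 := fun γ : (Fin m → Fin 3) → Fin 3 → ℝ => memLp_piecewiseHarmonic hh (ζ := ζ) γ
  have hint := fun γ γ' : (Fin m → Fin 3) → Fin 3 → ℝ =>
    (hL2 γ).integrable_mul (hL2 γ')
  let K : Submodule ℝ ((Fin m → Fin 3) → Fin 3 → ℝ) :=
    { carrier := {κ | ∃ s, HasLaplacian ζ s (piecewiseHarmonic h κ) ∧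
        ∀ (w : Fin m → Fin 3) i, cellMap w (q i) ∈ E →
          s (cellMap w (q i)) = 0 ∧ HasNormalDeriv s w i 0}
      add_mem' := by
        rintro κ κ' ⟨s, hs, h0⟩ ⟨s', hs', h0'⟩
        refine ⟨s + s', ?_, fun w i hE => ⟨?_, ?_⟩⟩
        · rw [piecewiseHarmonic_add]
          exact hs.add hh hs'
        · rw [Pi.add_apply, (h0 w i hE).1, (h0' w i hE).1, add_zero]
        · simpa using (h0 w i hE).2.add (h0' w i hE).2
      zero_mem' := by
        refine ⟨0, ?_, fun w i _ => ⟨rfl, ?_⟩⟩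
        · have h0 := piecewiseHarmonic_smul h 0 (0 : (Fin m → Fin 3) → Fin 3 → ℝ)
          rw [smul_zero, zero_smul] at h0
          rw [h0]
          exact (isHarmonic_const 0).hasLaplacian hh
        · simp [HasNormalDeriv]
      smul_mem' := by
        rintro c κ ⟨s, hs, h0⟩
        refine ⟨c • s, ?_, fun w i hE => ⟨?_, ?_⟩⟩
        · rw [piecewiseHarmonic_smul]
          exact hs.smul hh c
        · rw [Pi.smul_apply, (h0 w i hE).1, smul_zero]
        · simpa using (h0 w i hE).2.smul c }
  let B : LinearMap.BilinForm ℝ ((Fin m → Fin 3) → Fin 3 → ℝ) :=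
    LinearMap.mk₂ ℝ (fun γ γ' => ∫ x, piecewiseHarmonic h γ x * piecewiseHarmonic h γ' x ∂ζ)
      (fun γ γ' γ'' => by
        simp only [piecewiseHarmonic_add, Pi.add_apply, add_mul]
        exact integral_add (hint _ _) (hint _ _))
      (fun c γ γ' => by
        simp only [piecewiseHarmonic_smul, Pi.smul_apply, smul_eq_mul, mul_assoc,
          integral_const_mul])
      (fun γ γ' γ'' => by
        simp only [piecewiseHarmonic_add, Pi.add_apply, mul_add]
        exact integral_add (hint _ _) (hint _ _))
      (fun c γ γ' => by
        simp only [piecewiseHarmonic_smul, Pi.smul_apply, smul_eq_mul, mul_left_comm _ c,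
          integral_const_mul])
  have hB : ∀ γ γ', B γ γ' = ∫ x, piecewiseHarmonic h γ x * piecewiseHarmonic h γ' x ∂ζ :=
    fun _ _ => rfl
  have hrefl : B.IsRefl := fun γ γ' h0 => by
    rw [hB] at h0 ⊢
    simpa only [mul_comm] using h0
  -- The form is positive definite, since `ζ` charges every cell.
  have hdef : ∀ γ, B γ γ = 0 → γ = 0 := by
    intro γ h0
    rw [hB, integral_mul_piecewiseHarmonic hh (hL2 γ)] at h0
    have h1 : ∀ w, ∫ x, piecewiseHarmonic h γ (cellMap w x) * harmonicExt h (γ w) x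
        ∂cellMeasure ζ w =
        ∫ x, harmonicExt h (γ w) x * harmonicExt h (γ w) x ∂cellMeasure ζ w := fun w => by
      refine integral_congr_ae ?_
      filter_upwards [piecewiseHarmonic_ae_eq ζ h γ w] with x hx
      rw [hx]
    simp only [h1] at h0
    rw [Finset.sum_eq_zero_iff_of_nonneg fun w _ => integral_nonneg fun x => mul_self_nonneg _]
      at h0
    funext w
    exact eq_zero_of_integral_sq hh (h0 w (Finset.mem_univ _))
  have hdisj : Disjoint K (B.orthogonal K) := by
    rw [Submodule.disjoint_def]
    intro κ hκ hκ'
    exact hdef κ (LinearMap.BilinForm.mem_orthogonal_iff.1 hκ' κ hκ)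
  have hcompl := LinearMap.BilinForm.isCompl_orthogonal_of_restrict_nondegenerate hrefl
    (B.nondegenerate_restrict_of_disjoint_orthogonal hrefl hdisj)
  obtain ⟨κ, hκ, ω, hω, hsum⟩ := Submodule.mem_sup.1
    (hcompl.sup_eq_top ▸ Submodule.mem_top : γ₀ ∈ K ⊔ B.orthogonal K)
  obtain ⟨s, hs, h0⟩ := hκ
  refine ⟨s, κ, hs, h0, ?_⟩
  rw [← hsum, add_sub_cancel_left]
  exact matchesOff_of_orthogonal hh fun s' κ' hs' h0' =>
    LinearMap.BilinForm.mem_orthogonal_iff.1 hω κ' ⟨s', hs', h0'⟩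

/-- Some admissible function is biharmonic away from `E`. -/
theorem exists_admissible_isBiharmonicAwayFrom [ζ.IsOpenPosMeasure] {m : ℕ} {E : Set SG}
    {c : SG → (Fin m → Fin 3) × Fin 3} (hc : ∀ x ∈ E, cellMap (c x).1 (q (c x).2) = x)
    (a b : SG → ℝ) : ∃ u ∈ Admissible ζ E c a b, IsBiharmonicAwayFrom ζ m E u := by
  classical
  -- At a point of `E`, the normal derivatives are `b` for the chosen cell and `-b` for the other.
  set D : (Fin m → Fin 3) → Fin 3 → ℝ := fun w i => if cellMap w (q i) ∈ E then
    (if (c (cellMap w (q i))).1 = w then b (cellMap w (q i)) else -b (cellMap w (q i))) else 0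
    with hD
  have hm : ∀ w w' i j, w ≠ w' → cellMap w (q i) = cellMap w' (q j) → D w i + D w' j = 0 := by
    intro w w' i j hw he
    simp only [hD, ← he]
    by_cases hE : cellMap w (q i) ∈ E
    · rw [if_pos hE, if_pos hE]
      rcases address_eq_or_eq hw he (hc _ hE) with h1 | h1
      · rw [if_pos h1, if_neg (by rw [h1]; exact hw), add_neg_cancel]
      · rw [if_neg (by rw [h1]; exact hw.symm), if_pos h1, neg_add_cancel]
    · rw [if_neg hE, if_neg hE, add_zero]
  obtain ⟨u₀, γ₀, hu₀, hA, hflux⟩ := exists_biharmonic_spline hh (ζ := ζ) a hm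
  obtain ⟨s, κ, hs, h0, hmatch⟩ := exists_matchesOff_sub hh (ζ := ζ) E γ₀
  have hu : HasLaplacian ζ (u₀ - s) (piecewiseHarmonic h (γ₀ - κ)) := by
    have h1 := piecewiseHarmonic_add h (γ₀ - κ) κ
    rw [sub_add_cancel] at h1
    rw [eq_sub_of_add_eq h1.symm]
    exact hu₀.sub hh hs
  refine ⟨u₀ - s, ⟨⟨_, hu⟩, fun x hx => ?_⟩, hmatch.isBiharmonicAwayFrom hh hu⟩
  have hcx := hc x hx
  have hE : cellMap (c x).1 (q (c x).2) ∈ E := hcx.symm ▸ hx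
  constructor
  · have h1 := hA (c x).1 (c x).2
    have h2 := (h0 _ _ hE).1
    rw [hcx] at h1 h2
    rw [Pi.sub_apply, h1, h2, sub_zero]
  · have h1 := (hasNormalDeriv_cellFlux hh hu₀ (c x).1 (c x).2).sub (h0 _ _ hE).2
    have h2 : D (c x).1 (c x).2 = b x := by
      simp only [hD, hcx, if_pos hx, if_true]
    rwa [hflux, h2, sub_zero] at h1

/-- An admissible function that is biharmonic away from `E` minimizes `T_ζ`, by orthogonality; and
it is the only minimizer, since a harmonic function that vanishes on `E` is zero. -/
theorem T_le_of_isBiharmonicAwayFrom {m : ℕ} {E : Set SG} {x : Fin 3 → SG} (hxE : ∀ k, x k ∈ E)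
    (hx : IsUnit (Matrix.of fun k j => h j (x k)))
    {c : SG → (Fin m → Fin 3) × Fin 3} (hc : ∀ x ∈ E, cellMap (c x).1 (q (c x).2) = x)
    {a b : SG → ℝ} {u v : SG → ℝ} (hu : u ∈ Admissible ζ E c a b)
    (hub : IsBiharmonicAwayFrom ζ m E u) (hv : v ∈ Admissible ζ E c a b) :
    T ζ u ≤ T ζ v ∧ (T ζ v ≤ T ζ u → v = u) := by
  obtain ⟨γ, hγ, huL⟩ := exists_matchesOff hh hub
  obtain ⟨⟨f, hvL⟩, hvE⟩ := hv
  have hs := hvL.sub hh huL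
  set s := v - u with hsdef
  set g := piecewiseHarmonic h γ with hg
  have hs0 : ∀ y ∈ E, s y = 0 := fun y hy => by
    rw [hsdef, Pi.sub_apply, (hvE y hy).1, (hu.2 y hy).1, sub_self]
  have hsc : ∀ y ∈ E, cellFlux ζ h s (f - g) (c y).1 (c y).2 = 0 := fun y hy => by
    have := (hvE y hy).2.sub (hu.2 y hy).2
    rw [sub_self] at this
    exact (eq_cellFlux hh hs this).symm
  have horth := hγ.integral_eq_zero hh hs (fun w i hE => hs0 _ hE) fun w i hE => by
    have hcy := hc _ hE
    by_cases hw : (c (cellMap w (q i))).1 = w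
    · have h1 := hsc _ hE
      rw [hw] at h1 hcy
      rwa [address_index_eq hcy] at h1
    · have h1 := cellFlux_add_cellFlux hh hs hw hcy
      rwa [hsc _ hE, zero_add] at h1
  have hT : T ζ v = T ζ u + ∫ x, (f - g) x ^ 2 ∂ζ := by
    rw [T_eq hh hvL, T_eq hh huL]
    have h1 : ∀ x, f x ^ 2 = g x ^ 2 + (f - g) x ^ 2 + 2 * ((f - g) x * g x) := fun x => by
      rw [Pi.sub_apply]
      ring
    simp only [h1]
    rw [integral_add (f := fun x => g x ^ 2 + (f - g) x ^ 2) (g := fun x => 2 * ((f - g) x * g x))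
      (huL.2.1.integrable_sq.add hs.2.1.integrable_sq)
      ((hs.2.1.integrable_mul huL.2.1).const_mul 2),
      integral_add huL.2.1.integrable_sq hs.2.1.integrable_sq, integral_const_mul, horth, mul_zero,
      add_zero]
  have hnn : 0 ≤ ∫ x, (f - g) x ^ 2 ∂ζ := integral_nonneg fun x => sq_nonneg _
  refine ⟨by linarith, fun hle => ?_⟩
  have hz : ∫ x, (f - g) x ^ 2 ∂ζ = 0 := by linarith
  rw [integral_eq_zero_iff_of_nonneg (fun x => sq_nonneg _) hs.2.1.integrable_sq] at hz
  have hsL : HasLaplacian ζ s 0 := hs.congr_ae <| by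
    filter_upwards [hz] with y hy
    exact pow_eq_zero_iff two_ne_zero |>.1 hy
  have hsH := hh.eq_harmonicExt (hsL.isHarmonic hh)
  have hq : (fun i => s (q i)) = 0 := by
    refine Matrix.mulVec_injective_iff_isUnit.2 hx ?_
    rw [Matrix.mulVec_zero]
    funext k
    have h1 := hs0 _ (hxE k)
    rw [hsH, harmonicExt] at h1
    simpa only [Matrix.mulVec, dotProduct, Matrix.of_apply, mul_comm, Pi.zero_apply] using h1
  refine sub_eq_zero.1 ?_
  rw [← hsdef, hsH, hq]
  funext y
  simp [harmonicExt]

end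
end SierpinskiGasket
end

theorem mainTheorem10
    (ζ : Measure SierpinskiGasket.SG) [IsFiniteMeasure ζ] [ζ.IsOpenPosMeasure]
    (hζ : ∀ x, ζ {x} = 0)
    (m : ℕ) (E : Set SierpinskiGasket.SG) (hE : E ⊆ SierpinskiGasket.V m)
    (hH : SierpinskiGasket.HarmonicallyNondegenerate E)
    (c : SierpinskiGasket.SG → (Fin m → Fin 3) × Fin 3)
    (hc : ∀ x ∈ E, SierpinskiGasket.cellMap (c x).1 (SierpinskiGasket.q (c x).2) = x)
    (a b : SierpinskiGasket.SG → ℝ) :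
    (∃! u, SierpinskiGasket.IsMinimizer ζ (SierpinskiGasket.Admissible ζ E c a b) u) ∧
    (∀ u, SierpinskiGasket.IsMinimizer ζ (SierpinskiGasket.Admissible ζ E c a b) u →
      SierpinskiGasket.IsBiharmonicAwayFrom ζ m E u) ∧
    (∃! u, u ∈ SierpinskiGasket.Admissible ζ E c a b ∧
      SierpinskiGasket.IsBiharmonicAwayFrom ζ m E u) := by
  have : NullSingletonClass ζ := ⟨hζ⟩
  obtain ⟨h, hharm, hq, x, hxE, hx⟩ := hH
  have hh : SierpinskiGasket.IsHarmonicBasis h := ⟨hharm, hq⟩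
  obtain ⟨u, hu, hub⟩ := SierpinskiGasket.exists_admissible_isBiharmonicAwayFrom hh (ζ := ζ) hc a b
  have hmin := fun v hv => SierpinskiGasket.T_le_of_isBiharmonicAwayFrom hh hxE hx hc hu hub
    (v := v) hv
  have huniq : ∀ v, SierpinskiGasket.IsMinimizer ζ (SierpinskiGasket.Admissible ζ E c a b) v →
      v = u := fun v hv => (hmin v hv.1).2 (hv.2 u hu)
  refine ⟨⟨u, ⟨hu, fun v hv => (hmin v hv).1⟩, huniq⟩, fun v hv => huniq v hv ▸ hub,
    u, ⟨hu, hub⟩, fun v hv => ?_⟩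
  exact (hmin v hv.1).2 (SierpinskiGasket.T_le_of_isBiharmonicAwayFrom hh hxE hx hc hv.1 hv.2 hu).1
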